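/- A parameterized problem is a decision problem whose instances $x$ are encoded injectively as binary words, together with a parameter $\kappa(x)\in\mathbb N$. An fpt-reduction from $P$ to $Q$ is a map $r$ from the instances of $P$ to those of $Q$ such that (i) $x$ is a yes-instance of $P$ if and only if $r(x)$ is a yes-instance of $Q$; (ii) some deterministic Turing machine computes $r(x)$ from $x$ in at most $f(\kappa(x))\,(|x|+1)^{c}$ steps; (iii) $\kappa(r(x))\le g(\kappa(x))$, for some computable functions $f,g:\mathbb N\to\mathbb N$ and some constant $c$. Consider Boolean circuits with one output, built from NOT gates and AND and OR gates of arbitrary fan-in. The depth of a circuit is the maximum number of gates on a path to the output, and its weft is the maximum number of gates of fan-in greater than $2$ on such a path. The class $\mathrm W[2]$ consists of the parameterized problems that, for some constant $h$, have an fpt-reduction to the following problem: given a circuit $C$ of weft at most $2$ and depth at most $h$, and an integer $k\ge 0$ (the parameter), does $C$ accept some input of Hamming weight exactly $k$? For sets $\sigma,\rho\subseteq\mathbb N$ of non-negative integers, a set $D$ of vertices of a finite simple undirected graph $G$ is $(\sigma,\rho)$-dominating if $|N(v)\cap D|\in\sigma$ for every vertex $v\in D$ and $|N(v)\cap D|\in\rho$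 for every vertex $v\notin D$, where $N(v)$ is the set of neighbours of $v$. The problem $(\sigma,\rho)$-Dominating Set of Size at Most $k$ is: given a finite simple graph $G$ and an integer $k\ge 0$ (the parameter), does $G$ have a $(\sigma,\rho)$-dominating set $D$ with $|D|\le k$? Theorem. For all recursive (decidable) sets $\sigma,\rho\subseteq\mathbb N$, the problem $(\sigma,\rho)$-Dominating Set of Size at Most $k$, parameterized by $k$, belongs to $\mathrm W[2]$. -/

import Mathlib

namespace ParamComplexity

/-! ### Self-delimiting binary codes -/

/-- A code is prefix-free (self-delimiting) if concatenations can be parsed uniquely. -/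
def PrefixFree {α : Type} (e : α → List Bool) : Prop :=
  ∀ a b s t, e a ++ s = e b ++ t → a = b ∧ s = t

/-- The unary code `1ⁿ0` of a natural number. -/
def encodeNat : ℕ → List Bool
  | 0 => [false]
  | n + 1 => true :: encodeNat n

/-- The code of a list: every entry is announced by a `1`, the end of the list by a `0`. -/
def encodeList {α : Type} (e : α → List Bool) : List α → List Bool
  | [] => [false]
  | a :: l => true :: (e a ++ encodeList e l)

theorem prefixFree_encodeNat : PrefixFree encodeNat := by
  intro a
  induction a with
  | zero => rintro (_ | b) s t h <;> simp_all [encodeNat]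
  | succ a ih =>
    rintro (_ | b) s t h
    · simp [encodeNat] at h
    · simp only [encodeNat, List.cons_append, List.cons.injEq, true_and] at h
      obtain ⟨h₁, h₂⟩ := ih b s t h
      exact ⟨by rw [h₁], h₂⟩

theorem prefixFree_encodeList {α : Type} {e : α → List Bool} (he : PrefixFree e) :
    PrefixFree (encodeList e) := by
  intro a
  induction a with
  | nil => rintro (_ | ⟨b, m⟩) s t h <;> simp_all [encodeList]
  | cons a l ih =>
    rintro (_ | ⟨b, m⟩) s t h
    · simp [encodeList] at h
    · simp only [encodeList, List.cons_append, List.cons.injEq, true_and,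
        List.append_assoc] at h
      obtain ⟨h₁, h₂⟩ := he _ _ _ _ h
      obtain ⟨h₃, h₄⟩ := ih m s t h₂
      exact ⟨by rw [h₁, h₃], h₄⟩

/-! ### Parameterized problems and fpt-reductions -/

/-- A parameterized decision problem: instances are encoded injectively as binary words, each
instance has a parameter, and some of the instances are yes-instances. -/
structure ParamProblem where
  /-- the instances -/
  Inst : Type
  /-- the parameter of an instance -/
  param : Inst → ℕ
  /-- the binary word that represents an instance -/
  encode : Inst → List Bool
  encode_injective : Function.Injective encode
  /-- the yes-instances -/
  Yes : Inst → Prop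

/-- `FPTReducible P Q`: there is a many-one reduction from `P` to `Q` that
a (deterministic, multi-stack) Turing machine computes in at most `f(k) · (|x| + 1)^c` steps, where
`k` is the parameter and `|x|` the length of the input word, and under which the new parameter is at
most `g(k)`; here `f` and `g` are computable functions and `c` is a constant. -/
def FPTReducible (P Q : ParamProblem) : Prop :=
  ∃ (r : P.Inst → Q.Inst) (f g : ℕ → ℕ) (c : ℕ) (M : Turing.TM2ComputableAux Bool Bool),
    Computable f ∧ Computable g ∧
    (∀ x, P.Yes x ↔ Q.Yes (r x)) ∧
    (∀ x, Q.param (r x) ≤ g (P.param x)) ∧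
    (∀ x, Nonempty (Turing.TM2OutputsInTime M.tm
      ((P.encode x).map M.inputAlphabet.symm)
      (some ((Q.encode (r x)).map M.outputAlphabet.symm))
      (f (P.param x) * ((P.encode x).length + 1) ^ c)))

/-! ### Boolean circuits, depth and weft -/

/-- A gate of a Boolean circuit, with the list of the nodes that feed it. -/
inductive Gate where
  | not (a : ℕ)
  | and (as : List ℕ)
  | or (as : List ℕ)

namespace Gate

/-- The nodes that feed a gate. -/
def args : Gate → List ℕ
  | not a => [a]
  | and as => as
  | or as => as

/-- The output of a gate when node `i` carries the value `v i`. -/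
def eval (v : ℕ → Bool) : Gate → Bool
  | not a => !v a
  | and as => as.all v
  | or as => as.any v

/-- A gate is large if its fan-in exceeds two. -/
def isLarge (g : Gate) : Bool := decide (2 < g.args.length)

/-- The largest value of `d` on the nodes that feed the gate (`0` if there are none). -/
def maxArg (d : ℕ → ℕ) (g : Gate) : ℕ := (g.args.map d).foldr max 0

/-- The binary code of a gate. -/
def encode : Gate → List Bool
  | not a => false :: encodeNat a
  | and as => true :: false :: encodeList encodeNat as
  | or as => true :: true :: encodeList encodeNat as

theorem prefixFree_encode : PrefixFree encode := by
  have hl := prefixFree_encodeList prefixFree_encodeNat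
  rintro (a | a | a) (b | b | b) s t h <;> simp only [encode, List.cons_append, List.cons.injEq,
    reduceCtorEq, false_and, true_and] at h
  · obtain ⟨h₁, h₂⟩ := prefixFree_encodeNat _ _ _ _ h
    exact ⟨by rw [h₁], h₂⟩
  · obtain ⟨h₁, h₂⟩ := hl _ _ _ _ h
    exact ⟨by rw [h₁], h₂⟩
  · obtain ⟨h₁, h₂⟩ := hl _ _ _ _ h
    exact ⟨by rw [h₁], h₂⟩

end Gate

/-- Goes through a list of gates in order and appends to `vals`, the list of the values of the
earlier nodes, the value `step v g` of each gate `g`, where `v i` is the value of node `i`. -/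
def runGates {β : Type} [Inhabited β] (step : (ℕ → β) → Gate → β) :
    List β → List Gate → List β
  | vals, [] => vals
  | vals, g :: gs => runGates step (vals ++ [step (fun i => vals.getD i default) g]) gs

/-- A Boolean circuit with one output. The nodes `0, …, numInputs - 1` are the inputs, node
`numInputs + i` is the `i`-th gate, and every gate is fed by earlier nodes only. -/
@[ext]
structure Circuit where
  /-- the number of inputs -/
  numInputs : ℕ
  /-- the gates, in topological order -/
  gates : List Gate
  /-- the output node -/
  output : ℕ
  args_lt : ∀ (i : ℕ) (hi : i < gates.length), ∀ a ∈ gates[i].args, a < numInputs + i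
  output_lt : output < numInputs + gates.length

namespace Circuit

/-- The output of the circuit on the input `x`. -/
def eval (C : Circuit) (x : Fin C.numInputs → Bool) : Bool :=
  (runGates Gate.eval (List.ofFn x) C.gates).getD C.output false

/-- The depth: the maximum number of gates on a path to the output. -/
def depth (C : Circuit) : ℕ :=
  (runGates (fun d g => 1 + g.maxArg d) (List.replicate C.numInputs 0) C.gates).getD C.output 0

/-- The weft: the maximum number of large gates on a path to the output. -/
def weft (C : Circuit) : ℕ :=
  (runGates (fun d g => (if g.isLarge then 1 else 0) + g.maxArg d)
    (List.replicate C.numInputs 0) C.gates).getD C.output 0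

/-- Some input with exactly `k` ones is accepted. -/
def WeightedSat (C : Circuit) (k : ℕ) : Prop :=
  ∃ x : Fin C.numInputs → Bool,
    (Finset.univ.filter fun i => x i = true).card = k ∧ C.eval x = true

/-- The binary code of a circuit. -/
def encode (C : Circuit) : List Bool :=
  encodeNat C.numInputs ++ (encodeList Gate.encode C.gates ++ encodeNat C.output)

theorem encode_injective : Function.Injective encode := by
  intro C D h
  obtain ⟨h₁, h⟩ := prefixFree_encodeNat _ _ _ _ h
  obtain ⟨h₂, h⟩ := prefixFree_encodeList Gate.prefixFree_encode _ _ _ _ h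
  obtain ⟨h₃, -⟩ := prefixFree_encodeNat C.output D.output [] [] (by simpa using h)
  exact Circuit.ext h₁ h₂ h₃

end Circuit

/-- Weighted satisfiability of circuits of weft at most `t` and depth at most `h`: given such a
circuit and `k`, is there an accepted input of Hamming weight `k`? The parameter is `k`. -/
def weightedCircuitSat (t h : ℕ) : ParamProblem where
  Inst := {C : Circuit // C.weft ≤ t ∧ C.depth ≤ h} × ℕ
  param x := x.2
  encode x := encodeNat x.2 ++ x.1.1.encode
  encode_injective := by
    rintro ⟨⟨C, hC⟩, k⟩ ⟨⟨D, hD⟩, l⟩ h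
    obtain ⟨h₁, h₂⟩ := prefixFree_encodeNat _ _ _ _ h
    obtain rfl := Circuit.encode_injective h₂
    obtain rfl : k = l := h₁
    rfl
  Yes x := x.1.1.WeightedSat x.2

/-- The class `W[t]`: the parameterized problems that are fpt-reducible to weighted satisfiability
of circuits of weft at most `t` and depth at most `h`, for some constant `h`. -/
def W (t : ℕ) : Set ParamProblem :=
  {P | ∃ h : ℕ, FPTReducible P (weightedCircuitSat t h)}

/-! ### `(σ, ρ)`-domination -/

/-- `D` is a `(σ, ρ)`-dominating set of the graph `G`. -/
def IsSigmaRhoDominating {V : Type} (σ ρ : Set ℕ) (G : SimpleGraph V) (D : Finset V) : Prop :=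
  (∀ v ∈ D, (G.neighborSet v ∩ D).ncard ∈ σ) ∧ (∀ v ∉ D, (G.neighborSet v ∩ D).ncard ∈ ρ)

/-- A finite graph, on the vertices `0, …, n - 1`, together with a number `k`. -/
structure GraphInst where
  /-- the number of vertices -/
  n : ℕ
  /-- the graph -/
  G : SimpleGraph (Fin n)
  /-- the bound on the size of the set -/
  k : ℕ

open Classical in
/-- The rows of the adjacency matrix of a graph, one after the other. -/
noncomputable def adjBits {n : ℕ} (G : SimpleGraph (Fin n)) : List Bool :=
  (List.finRange n).flatMap fun i => (List.finRange n).map fun j => decide (G.Adj i j)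

theorem adjBits_injective {n : ℕ} : Function.Injective (adjBits (n := n)) := by
  classical
  intro G H h
  have key : ∀ l : List (Fin n),
      (l.flatMap fun i => (List.finRange n).map fun j => decide (G.Adj i j)) =
        (l.flatMap fun i => (List.finRange n).map fun j => decide (H.Adj i j)) →
      ∀ i ∈ l, ∀ j, G.Adj i j ↔ H.Adj i j := by
    intro l
    induction l with
    | nil => simp
    | cons a l ih =>
      intro hl i hi j
      rw [List.flatMap_cons, List.flatMap_cons] at hl
      obtain ⟨h₁, h₂⟩ := List.append_inj hl (by simp)
      rcases List.mem_cons.1 hi with rfl | hi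
      · simpa using List.map_inj_left.1 h₁ j (List.mem_finRange j)
      · exact ih h₂ i hi j
  ext i j
  refine key (List.finRange n) ?_ i (List.mem_finRange i) j
  unfold adjBits at h
  convert h

/-- The binary code of a graph and a number `k`: `n` and `k` in unary, then the adjacency matrix. -/
noncomputable def GraphInst.encode (x : GraphInst) : List Bool :=
  encodeNat x.n ++ (encodeNat x.k ++ adjBits x.G)

theorem GraphInst.encode_injective : Function.Injective GraphInst.encode := by
  rintro ⟨n, G, k⟩ ⟨m, H, l⟩ h
  obtain ⟨h₁, h⟩ := prefixFree_encodeNat _ _ _ _ h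
  obtain ⟨h₂, h₃⟩ := prefixFree_encodeNat _ _ _ _ h
  obtain rfl : n = m := h₁
  obtain rfl : k = l := h₂
  obtain rfl : G = H := adjBits_injective h₃
  rfl

/-- `(σ, ρ)`-Dominating Set of Size at Most `k`: given a graph `G` and `k`, is there a
`(σ, ρ)`-dominating set of `G` with at most `k` vertices? The parameter is `k`. -/
noncomputable def sigmaRhoDominatingSet (σ ρ : Set ℕ) : ParamProblem where
  Inst := GraphInst
  param x := x.k
  encode := GraphInst.encode
  encode_injective := GraphInst.encode_injective
  Yes x := ∃ D : Finset (Fin x.n), IsSigmaRhoDominating σ ρ x.G D ∧ D.card ≤ x.k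

end ParamComplexity

/-! A set of at most k vertices is given by k choices, each a vertex or a blank (`Fin.last n`), with
no vertex chosen twice. Seen from a vertex v, every choice is v itself, a neighbour of v, or
neither, so v sees a word of length k over three letters, and this word decides whether v is
satisfied: the number of letters 0 tells whether v is chosen (two of them betray a repetition, which
is rejected), and the number of letters 1 is |N(v) ∩ D|. The latter is at most k, so only the values
of the characteristic functions on 0, …, k matter, and the list of forbidden words, at most 3^k of
them, is computable from k alone.

Take a Boolean variable for each pair (p, i), meaning "the i-th choice is p". For every i a clause
demands that some (p, i) is true; since exactly k variables are true, each i then has exactly one p,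
and no negative clause is needed. For every v and every forbidden word b, the clause of all (p, i)
with `kind G v p ≠ b i` says that v does not see b. The conjunction of these positive clauses is a
circuit of weft and depth at most 2. The equivalence is carried by `cnfCircuit_eval`,
`exists_choice_iff` and `exists_dominating_iff`.

The reduction must also run on a Turing machine within f(k) times a polynomial. It is written in a
small language of stack programs, which `Runs.stepsTo` turns into machine code step for step. The
decision procedures for σ and ρ enter only through the forbidden words: `leads_ofCode` interprets
codes of partial recursive functions by stack programs, and `exists_table_prog` yields a program for
the table of forbidden words. Its running time needs no estimate. It depends on k only, and it is
computable because the step-counting evaluator of programs is partial recursive (`partrec_eval`) and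
the program always stops. All other work is done by explicit programs whose time is polynomial in n,
k and the number of forbidden words (`runsIn_writeProg`, `writeTime_le`). -/

/-! ### A structured language of stack programs -/

/-- Programs that act on finitely many stacks of bits, indexed by `K`. Tests inspect the top of a
stack. -/
inductive Prog (K : Type) where
  | push (k : K) (b : Bool)
  | pop (k : K)
  | seq (p q : Prog K)
  | ite (k : K) (c : Option Bool → Bool) (p q : Prog K)
  | loop (k : K) (c : Option Bool → Bool) (p : Prog K)

namespace Prog

infixr:60 ";;" => Prog.seq

variable {K : Type} [DecidableEq K]

/-- `Runs p S t S'`: started on the stacks `S`, the program `p` stops after `t` steps with the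
stacks `S'`. -/
inductive Runs : Prog K → (K → List Bool) → ℕ → (K → List Bool) → Prop
  | push (k b S) : Runs (.push k b) S 1 (Function.update S k (b :: S k))
  | pop (k S) : Runs (.pop k) S 1 (Function.update S k (S k).tail)
  | seq {p q S S₁ S₂ t₁ t₂} : Runs p S t₁ S₁ → Runs q S₁ t₂ S₂ → Runs (.seq p q) S (t₁ + t₂) S₂
  | ite_true {k c p q S S₁ t} : c (S k).head? = true → Runs p S t S₁ →
      Runs (.ite k c p q) S (t + 1) S₁
  | ite_false {k c p q S S₁ t} : c (S k).head? = false → Runs q S t S₁ →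
      Runs (.ite k c p q) S (t + 1) S₁
  | loop_true {k c p S S₁ S₂ t₁ t₂} : c (S k).head? = true → Runs p S t₁ S₁ →
      Runs (.loop k c p) S₁ t₂ S₂ → Runs (.loop k c p) S (1 + t₁ + t₂) S₂
  | loop_false {k c p S} : c (S k).head? = false → Runs (.loop k c p) S 1 S

/-- `p` leads from `S` to `S'` in at most `T` steps. -/
def RunsIn (p : Prog K) (S : K → List Bool) (T : ℕ) (S' : K → List Bool) : Prop :=
  ∃ t ≤ T, Runs p S t S'

/-! ### Composition rules for time bounds. -/

section rules

variable {p q : Prog K} {S S₁ S₂ : K → List Bool} {T T₁ T₂ : ℕ} {k : K} {c : Option Bool → Bool}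

theorem Runs.runsIn {t : ℕ} (h : Runs p S t S₁) : RunsIn p S t S₁ := ⟨t, le_rfl, h⟩

theorem RunsIn.mono (h : RunsIn p S T₁ S₁) (hT : T₁ ≤ T₂) : RunsIn p S T₂ S₁ :=
  let ⟨t, ht, hr⟩ := h
  ⟨t, ht.trans hT, hr⟩

theorem RunsIn.congr (h : RunsIn p S T₁ S₁) (hT : T₁ ≤ T₂) (hS : S₁ = S₂) : RunsIn p S T₂ S₂ :=
  hS ▸ h.mono hT

theorem RunsIn.seq (h₁ : RunsIn p S T₁ S₁) (h₂ : RunsIn q S₁ T₂ S₂) :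
    RunsIn (p ;; q) S (T₁ + T₂) S₂ :=
  let ⟨_, ht, hr⟩ := h₁
  let ⟨_, ht', hr'⟩ := h₂
  ⟨_, Nat.add_le_add ht ht', .seq hr hr'⟩

theorem runsIn_push (k : K) (b : Bool) (S : K → List Bool) :
    RunsIn (.push k b) S 1 (Function.update S k (b :: S k)) := (Runs.push k b S).runsIn

theorem runsIn_pop (k : K) (S : K → List Bool) :
    RunsIn (.pop k) S 1 (Function.update S k (S k).tail) := (Runs.pop k S).runsIn

theorem RunsIn.ite_true (hc : c (S k).head? = true) (h : RunsIn p S T S₁) :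
    RunsIn (.ite k c p q) S (T + 1) S₁ :=
  let ⟨_, ht, hr⟩ := h
  ⟨_, Nat.add_le_add_right ht 1, .ite_true hc hr⟩

theorem RunsIn.ite_false (hc : c (S k).head? = false) (h : RunsIn q S T S₁) :
    RunsIn (.ite k c p q) S (T + 1) S₁ :=
  let ⟨_, ht, hr⟩ := h
  ⟨_, Nat.add_le_add_right ht 1, .ite_false hc hr⟩

theorem RunsIn.loop_true (hc : c (S k).head? = true) (h₁ : RunsIn p S T₁ S₁)
    (h₂ : RunsIn (.loop k c p) S₁ T₂ S₂) : RunsIn (.loop k c p) S (1 + T₁ + T₂) S₂ :=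
  let ⟨_, ht, hr⟩ := h₁
  let ⟨_, ht', hr'⟩ := h₂
  ⟨_, by omega, .loop_true hc hr hr'⟩

theorem RunsIn.loop_false (hc : c (S k).head? = false) : RunsIn (.loop k c p) S 1 S :=
  (Runs.loop_false hc).runsIn

end rules

/-! #### Renaming stacks -/

/-- Rename the stacks of a program. -/
def map {K L : Type} (f : K → L) : Prog K → Prog L
  | push k b => .push (f k) b
  | pop k => .pop (f k)
  | seq p q => .seq (p.map f) (q.map f)
  | ite k c p q => .ite (f k) c (p.map f) (q.map f)
  | loop k c p => .loop (f k) c (p.map f)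

/-- This allows the four-stack program for the forbidden words to run inside the full machine, at
the same cost and without touching the other stacks. -/
theorem Runs.map_inl {L : Type} [DecidableEq L] {p : Prog K} {S S' : K → List Bool} {t : ℕ}
    (h : Runs p S t S') (R : L → List Bool) :
    Runs (p.map Sum.inl) (Sum.elim S R) t (Sum.elim S' R) := by
  induction h with
  | push k b S =>
    rw [← Sum.update_elim_inl]
    exact Runs.push (Sum.inl k) b (Sum.elim S R)
  | pop k S =>
    rw [← Sum.update_elim_inl]
    exact Runs.pop (Sum.inl k) (Sum.elim S R)
  | seq _ _ ih₁ ih₂ => exact .seq ih₁ ih₂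
  | ite_true hc _ ih => exact .ite_true hc ih
  | ite_false hc _ ih => exact .ite_false hc ih
  | loop_true hc _ _ ih₁ ih₂ => exact .loop_true hc ih₁ ih₂
  | loop_false hc => exact .loop_false hc

/-! #### The total length of the stacks grows by at most one in each step -/

/-- What a run leaves behind is thus bounded by the input and the time spent, so emptying the stacks
at the end is paid for without tracking their individual lengths. -/
theorem Runs.sum_length_le [Fintype K] {p : Prog K} {S S' : K → List Bool} {t : ℕ}
    (h : Runs p S t S') : ∑ k, (S' k).length ≤ ∑ k, (S k).length + t := by
  have upd : ∀ (S : K → List Bool) (k : K) (l : List Bool), l.length ≤ (S k).length + 1 →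
      ∑ j, (Function.update S k l j).length ≤ ∑ j, (S j).length + 1 := by
    intro S k l hl
    rw [← Finset.add_sum_erase _ _ (Finset.mem_univ k),
      ← Finset.add_sum_erase (a := k) _ (fun j => (S j).length) (Finset.mem_univ k)]
    rw [Finset.sum_congr rfl (g := fun j => (S j).length)]
    · simp only [Function.update_self]; omega
    · intro j hj
      rw [Function.update_of_ne (Finset.ne_of_mem_erase hj)]
  induction h with
  | push k b S => exact upd S k _ (by simp)
  | pop k S => exact upd S k _ (by simp; omega)
  | seq _ _ ih₁ ih₂ => omega
  | ite_true hc _ ih => omega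
  | ite_false hc _ ih => omega
  | loop_true hc _ _ ih₁ ih₂ => omega
  | loop_false hc => omega

/-! #### The number of steps as a partial recursive function -/

/-- The final stacks and the number of steps of a program. -/
def eval : Prog K → (K → List Bool) → Part ((K → List Bool) × ℕ)
  | push k b => fun S => Part.some (Function.update S k (b :: S k), 1)
  | pop k => fun S => Part.some (Function.update S k (S k).tail, 1)
  | seq p q => fun S =>
    (p.eval S).bind fun r => (q.eval r.1).map fun r' => (r'.1, r.2 + r'.2)
  | ite k c p q => fun S =>
    (bif c (S k).head? then p.eval S else q.eval S).map fun r => (r.1, r.2 + 1)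
  | loop k c p => fun S =>
    PFun.fix (fun a : (K → List Bool) × ℕ =>
      bif c (a.1 k).head? then (p.eval a.1).map fun r => Sum.inr (r.1, a.2 + (1 + r.2))
      else Part.some (Sum.inl (a.1, a.2 + 1))) (S, 0)

theorem Runs.mem_eval {p : Prog K} {S S' : K → List Bool} {t : ℕ} (h : Runs p S t S') :
    (S', t) ∈ p.eval S := by
  induction p generalizing S S' t with
  | push k b => cases h; simp [eval]
  | pop k => cases h; simp [eval]
  | seq p q ihp ihq =>
    cases h with
    | seq h₁ h₂ =>
      simp only [eval, Part.mem_bind_iff, Part.mem_map_iff]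
      exact ⟨_, ihp h₁, _, ihq h₂, rfl⟩
  | ite k c p q ihp ihq =>
    cases h with
    | ite_true hc h =>
      simp only [eval, hc, cond_true, Part.mem_map_iff]
      exact ⟨_, ihp h, rfl⟩
    | ite_false hc h =>
      simp only [eval, hc, cond_false, Part.mem_map_iff]
      exact ⟨_, ihq h, rfl⟩
  | loop k c p ih =>
    -- The counter starts from an arbitrary `a`, because it has already advanced when the induction
    -- enters the second round.
    have key : ∀ a, (S', a + t) ∈ PFun.fix (fun a : (K → List Bool) × ℕ =>
        bif c (a.1 k).head? then (p.eval a.1).map fun r => Sum.inr (r.1, a.2 + (1 + r.2))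
        else Part.some (Sum.inl (a.1, a.2 + 1))) (S, a) := by
      generalize hq : loop k c p = q at h
      induction h with
      | push | pop | seq | ite_true | ite_false => cases hq
      | @loop_true _ _ _ S S₁ S₂ t₁ t₂ hc h₁ _ _ ih₂ =>
        cases hq
        intro a
        refine PFun.mem_fix_iff.2 (Or.inr ⟨(S₁, a + (1 + t₁)), ?_, ?_⟩)
        · simp only [hc, cond_true, Part.mem_map_iff]
          exact ⟨_, ih h₁, rfl⟩
        · rw [← Nat.add_assoc a (1 + t₁) t₂]
          exact ih₂ rfl _
      | loop_false hc =>
        cases hq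
        intro a
        exact PFun.mem_fix_iff.2 (Or.inl (by simp [hc]))
    simpa [eval] using key 0

/-- Every constructor of programs matches a closure property of partial recursive functions, with
`Partrec.fix` for loops. Indexing the stacks by `Fin m` makes the states encodable. -/
theorem partrec_eval {m : ℕ} (p : Prog (Fin m)) : Partrec p.eval := by
  have upd : ∀ k : Fin m, Primrec₂ fun (S : Fin m → List Bool) (l : List Bool) =>
      Function.update S k l := by
    intro k
    refine Primrec.fin_curry.2 ?_
    have : Primrec fun a : ((Fin m → List Bool) × List Bool) × Fin m =>
        if a.2 = k then a.1.2 else a.1.1 a.2 :=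
      Primrec.ite (Primrec.eq.comp Primrec.snd (Primrec.const k))
        (Primrec.snd.comp Primrec.fst)
        (Primrec.fin_app.comp (Primrec.fst.comp Primrec.fst) Primrec.snd)
    exact this.of_eq fun a => by simp [Function.update_apply]
  have get : ∀ k : Fin m, Primrec fun S : Fin m → List Bool => S k := fun k =>
    Primrec.fin_app.comp Primrec.id (Primrec.const k)
  -- The test `c` is arbitrary, but its domain is finite.
  have test : ∀ (k : Fin m) (c : Option Bool → Bool),
      Primrec fun S : Fin m → List Bool => c (S k).head? := fun k c =>
    (Primrec.dom_finite c).comp (Primrec.list_head?.comp (get k))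
  induction p with
  | push k b =>
    exact (((upd k).comp .id (Primrec.list_cons.comp (.const b) (get k))).pair
      (.const 1)).to_comp.partrec
  | pop k =>
    exact (((upd k).comp .id (Primrec.list_tail.comp (get k))).pair (.const 1)).to_comp.partrec
  | seq p q ihp ihq =>
    refine ihp.bind ?_
    refine Partrec.map (ihq.comp (Computable.fst.comp Computable.snd)) ?_
    exact Computable.pair (Computable.fst.comp Computable.snd)
      (Primrec.nat_add.to_comp.comp (Computable.snd.comp (Computable.snd.comp Computable.fst))
        (Computable.snd.comp Computable.snd))
  | ite k c p q ihp ihq =>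
    refine Partrec.map (Partrec.cond (test k c).to_comp ihp ihq) ?_
    exact Computable.pair (Computable.fst.comp Computable.snd)
      (Computable.succ.comp (Computable.snd.comp Computable.snd))
  | loop k c p ih =>
    refine (Partrec.fix ?_).comp (Computable.pair Computable.id (Computable.const 0))
    refine Partrec.cond ((test k c).to_comp.comp Computable.fst) ?_ ?_
    · refine Partrec.map (ih.comp Computable.fst) ?_
      refine Computable.sumInr.comp (Computable.pair (Computable.fst.comp Computable.snd) ?_)
      exact Primrec.nat_add.to_comp.comp (Computable.snd.comp Computable.fst)
        (Primrec.nat_add.to_comp.comp (Computable.const 1) (Computable.snd.comp Computable.snd))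
    · exact (Computable.sumInl.comp (Computable.pair Computable.fst
        (Computable.succ.comp Computable.snd))).partrec

/-- The number of steps of a program that stops on all the stacks `S a` is computable. -/
theorem computable_time {α : Type} [Primcodable α] {m : ℕ} {p : Prog (Fin m)}
    {S S' : α → Fin m → List Bool} {t : α → ℕ} (hS : Computable S)
    (h : ∀ a, Runs p (S a) (t a) (S' a)) : Computable t := by
  have : Partrec fun a => (p.eval (S a)).map Prod.snd :=
    Partrec.map ((partrec_eval p).comp hS) (Computable.snd.comp Computable.snd)
  exact this.of_eq fun a => by
    rw [Part.eq_some_iff.2 (h a).mem_eval, Part.map_some]; rfl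

end Prog

namespace Prog

/-! ### Stack programs as Turing machines -/

section compile

variable {K : Type}

/-- The control points of a program. -/
def Label : Prog K → Type
  | push _ _ => Unit
  | pop _ => Unit
  | seq p q => p.Label ⊕ q.Label
  | ite _ _ p q => Unit ⊕ (p.Label ⊕ q.Label)
  | loop _ _ p => Unit ⊕ p.Label

instance fintypeLabel : (p : Prog K) → Fintype p.Label
  | push _ _ => inferInstanceAs (Fintype Unit)
  | pop _ => inferInstanceAs (Fintype Unit)
  | seq p q =>
    have := fintypeLabel p
    have := fintypeLabel q
    inferInstanceAs (Fintype (p.Label ⊕ q.Label))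
  | ite _ _ p q =>
    have := fintypeLabel p
    have := fintypeLabel q
    inferInstanceAs (Fintype (Unit ⊕ (p.Label ⊕ q.Label)))
  | loop _ _ p =>
    have := fintypeLabel p
    inferInstanceAs (Fintype (Unit ⊕ p.Label))

/-- The control point at which a program starts. -/
def entry : (p : Prog K) → p.Label
  | push _ _ => ()
  | pop _ => ()
  | seq p _ => Sum.inl p.entry
  | ite _ _ _ _ => Sum.inl ()
  | loop _ _ _ => Sum.inl ()

/-- Machine statements over the stacks `K`; the internal state holds the bit that was read last. -/
abbrev MStmt (K Λ : Type) := Turing.TM2.Stmt (fun _ : K => Bool) Λ (Option Bool)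

/-- The machine code of a program, whose control points are embedded into the labels by `ι`, and
that goes to the label `exit` in the end. -/
def code {Λ : Type} : (p : Prog K) → (ι : p.Label → Λ) → (exit : Λ) → p.Label → MStmt K Λ
  | push k b, _, exit => fun _ => .push k (fun _ => b) (.goto fun _ => exit)
  | pop k, _, exit => fun _ => .pop k (fun _ s => s) (.goto fun _ => exit)
  | seq p q, ι, exit =>
    Sum.elim (p.code (fun l => ι (Sum.inl l)) (ι (Sum.inr q.entry)))
      (q.code (fun l => ι (Sum.inr l)) exit)
  | ite k c p q, ι, exit =>
    Sum.elim
      (fun _ => .peek k (fun _ s => s) (.branch c (.goto fun _ => ι (Sum.inr (Sum.inl p.entry)))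
        (.goto fun _ => ι (Sum.inr (Sum.inr q.entry)))))
      (Sum.elim (p.code (fun l => ι (Sum.inr (Sum.inl l))) exit)
        (q.code (fun l => ι (Sum.inr (Sum.inr l))) exit))
  | loop k c p, ι, exit =>
    Sum.elim
      (fun _ => .peek k (fun _ s => s) (.branch c (.goto fun _ => ι (Sum.inr p.entry))
        (.goto fun _ => exit)))
      (p.code (fun l => ι (Sum.inr l)) (ι (Sum.inl ())))

variable [DecidableEq K]

/-- The machine with the program `M` goes from configuration `a` to `b` in exactly `t` steps. -/
def StepsTo {Λ : Type} (M : Λ → MStmt K Λ)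
    (a : Turing.TM2.Cfg (fun _ : K => Bool) Λ (Option Bool)) (t : ℕ)
    (b : Turing.TM2.Cfg (fun _ : K => Bool) Λ (Option Bool)) : Prop :=
  (flip bind (Turing.TM2.step M))^[t] (some a) = some b

theorem StepsTo.trans {Λ : Type} {M : Λ → MStmt K Λ}
    {a b c : Turing.TM2.Cfg (fun _ : K => Bool) Λ (Option Bool)} {t u : ℕ}
    (h₁ : StepsTo M a t b) (h₂ : StepsTo M b u c) : StepsTo M a (t + u) c := by
  unfold StepsTo at *
  rw [Nat.add_comm, Function.iterate_add_apply, h₁, h₂]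

theorem stepsTo_one {Λ : Type} {M : Λ → MStmt K Λ} {l : Λ} {v : Option Bool}
    {S : K → List Bool} : StepsTo M ⟨some l, v, S⟩ 1 (Turing.TM2.stepAux (M l) v S) := rfl

/-- Every push, pop and test is compiled to a single label, so the step counts agree exactly. The
embedding `ι` and the label `exit` are arbitrary because subprograms sit inside the label type of
the surrounding program; the old state `v` does not matter, as every test reads its bit afresh. -/
theorem Runs.stepsTo {p : Prog K} {S S' : K → List Bool} {t : ℕ} (h : Runs p S t S')
    {Λ : Type} (M : Λ → MStmt K Λ) (ι : p.Label → Λ) (exit : Λ)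
    (hM : ∀ l, M (ι l) = p.code ι exit l) (v : Option Bool) :
    ∃ v', StepsTo M ⟨some (ι p.entry), v, S⟩ t ⟨some exit, v', S'⟩ := by
  induction h generalizing exit v with
  | push k b S =>
    have h := stepsTo_one (M := M) (l := ι (entry (.push k b))) (v := v) (S := S)
    rw [hM] at h
    exact ⟨_, h⟩
  | pop k S =>
    have h := stepsTo_one (M := M) (l := ι (entry (.pop k))) (v := v) (S := S)
    rw [hM] at h
    exact ⟨_, h⟩
  | @seq p q _ _ _ _ _ _ _ ih₁ ih₂ =>
    obtain ⟨v₁, h₁⟩ := ih₁ (fun l => ι (Sum.inl l)) (ι (Sum.inr q.entry))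
      (fun l => hM (Sum.inl l)) v
    obtain ⟨v₂, h₂⟩ := ih₂ (fun l => ι (Sum.inr l)) exit (fun l => hM (Sum.inr l)) v₁
    exact ⟨v₂, h₁.trans h₂⟩
  | @ite_true k c p q S _ _ hc _ ih =>
    obtain ⟨v₁, h₁⟩ := ih (fun l => ι (Sum.inr (Sum.inl l))) exit
      (fun l => hM (Sum.inr (Sum.inl l))) (S k).head?
    have h := stepsTo_one (M := M) (l := ι (entry (.ite k c p q))) (v := v) (S := S)
    rw [hM] at h
    simp only [entry, code, Sum.elim_inl, Turing.TM2.stepAux, hc, cond_true] at h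
    exact ⟨v₁, Nat.add_comm 1 _ ▸ h.trans h₁⟩
  | @ite_false k c p q S _ _ hc _ ih =>
    obtain ⟨v₁, h₁⟩ := ih (fun l => ι (Sum.inr (Sum.inr l))) exit
      (fun l => hM (Sum.inr (Sum.inr l))) (S k).head?
    have h := stepsTo_one (M := M) (l := ι (entry (.ite k c p q))) (v := v) (S := S)
    rw [hM] at h
    simp only [entry, code, Sum.elim_inl, Turing.TM2.stepAux, hc, cond_false] at h
    exact ⟨v₁, Nat.add_comm 1 _ ▸ h.trans h₁⟩
  | @loop_true k c p S _ _ _ _ hc _ _ ih₁ ih₂ =>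
    obtain ⟨v₁, h₁⟩ := ih₁ (fun l => ι (Sum.inr l)) (ι (Sum.inl ()))
      (fun l => hM (Sum.inr l)) (S k).head?
    obtain ⟨v₂, h₂⟩ := ih₂ ι exit hM v₁
    have h := stepsTo_one (M := M) (l := ι (entry (.loop k c p))) (v := v) (S := S)
    rw [hM] at h
    simp only [entry, code, Sum.elim_inl, Turing.TM2.stepAux, hc, cond_true] at h
    exact ⟨v₂, (h.trans h₁).trans h₂⟩
  | @loop_false k c p S hc =>
    have h := stepsTo_one (M := M) (l := ι (entry (.loop k c p))) (v := v) (S := S)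
    rw [hM] at h
    simp only [entry, code, Sum.elim_inl, Turing.TM2.stepAux, hc, cond_false] at h
    exact ⟨_, h⟩

variable [Fintype K]

/-- The machine that runs a program and stops. -/
def machine (p : Prog K) (k₀ k₁ : K) : Turing.FinTM2 where
  K := K
  k₀ := k₀
  k₁ := k₁
  Γ _ := Bool
  Λ := Option p.Label
  main := some p.entry
  σ := Option Bool
  initialState := none
  Γk₀Fin := inferInstanceAs (Fintype Bool)
  m
    | none => .load (fun _ => none) .halt
    | some l => p.code some none l

/-- The machine of a program, with bits as input and output alphabet. -/
def computer (p : Prog K) (k₀ k₁ : K) : Turing.TM2ComputableAux Bool Bool where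
  tm := p.machine k₀ k₁
  inputAlphabet := Equiv.refl Bool
  outputAlphabet := Equiv.refl Bool

/-- The initial and halting configurations of the machine have all stacks empty except the input or
output stack, so the program has to clean up after itself. -/
theorem RunsIn.outputsInTime {p : Prog K} {k₀ k₁ : K} {x y : List Bool} {T : ℕ}
    (h : RunsIn p (Function.update (fun _ => []) k₀ x) T (Function.update (fun _ => []) k₁ y)) :
    Nonempty (Turing.TM2OutputsInTime (p.computer k₀ k₁).tm
      (x.map (p.computer k₀ k₁).inputAlphabet.symm)
      (some (y.map (p.computer k₀ k₁).outputAlphabet.symm)) (T + 1)) := by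
  obtain ⟨t, ht, hr⟩ := h
  obtain ⟨v, hv⟩ := hr.stepsTo (p.machine k₀ k₁).m some none (fun _ => rfl) none
  -- The additional step halts and resets the internal state, which a halting configuration requires
  -- to be the initial one.
  have hend : StepsTo (p.machine k₀ k₁).m ⟨some none, v, Function.update (fun _ => []) k₁ y⟩ 1
      ⟨none, none, Function.update (fun _ => []) k₁ y⟩ := stepsTo_one
  refine ⟨⟨⟨t + 1, ?_⟩, Nat.add_le_add_right ht 1⟩⟩
  have hall := hv.trans hend
  unfold StepsTo at hall
  have e₁ : ∀ l : List Bool, Turing.initList (p.computer k₀ k₁).tm l =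
      (⟨some (some p.entry), none, Function.update (fun _ => []) k₀ l⟩ :
        Turing.TM2.Cfg (fun _ : K => Bool) (Option p.Label) (Option Bool)) := by
    intro l
    refine congrArg (Turing.TM2.Cfg.mk (some (some p.entry)) none) (funext fun j => ?_)
    by_cases hj : k₀ = j
    · subst hj
      exact (dif_pos rfl).trans (Function.update_self (β := fun _ => List Bool) _ l _).symm
    · exact (dif_neg (Ne.symm hj)).trans
        (Function.update_of_ne (β := fun _ => List Bool) (Ne.symm hj) l fun _ => []).symm
  have e₂ : ∀ l : List Bool, Turing.haltList (p.computer k₀ k₁).tm l =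
      (⟨none, none, Function.update (fun _ => []) k₁ l⟩ :
        Turing.TM2.Cfg (fun _ : K => Bool) (Option p.Label) (Option Bool)) := by
    intro l
    refine congrArg (Turing.TM2.Cfg.mk none none) (funext fun j => ?_)
    by_cases hj : k₁ = j
    · subst hj
      exact (dif_pos rfl).trans (Function.update_self (β := fun _ => List Bool) _ l _).symm
    · exact (dif_neg (Ne.symm hj)).trans
        (Function.update_of_ne (β := fun _ => List Bool) (Ne.symm hj) l fun _ => []).symm
  have hx : x.map (p.computer k₀ k₁).inputAlphabet.symm = x := List.map_id x
  have hy : y.map (p.computer k₀ k₁).outputAlphabet.symm = y := List.map_id y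
  rw [Option.map_some, hx, hy, e₁, e₂]
  exact hall

end compile

end Prog

namespace Prog

open ParamComplexity Turing.ToPartrec

/-! ### Moving unary numbers and lists of unary numbers between stacks -/

section macros

variable {K : Type}

/-- The top of the stack is a `1`. -/
def isOne (o : Option Bool) : Bool := o == some true

/-- Move a unary number from stack `a` to stack `b`. -/
def moveNum (a b : K) : Prog K :=
  .push b false ;; .loop a isOne (.pop a ;; .push b true) ;; .pop a

/-- Move a unary number from stack `a` to both of the stacks `b` and `c`. -/
def copyNum (a b c : K) : Prog K :=
  .push b false ;; .push c false ;;
    .loop a isOne (.pop a ;; .push b true ;; .push c true) ;; .pop a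

/-- Delete a unary number from stack `a`. -/
def dropNum (a : K) : Prog K := .loop a isOne (.pop a) ;; .pop a

/-- Move a list of numbers from stack `a` to stack `b`, reversing it. -/
def moveList (a b : K) : Prog K :=
  .push b false ;; .loop a isOne (.pop a ;; moveNum a b ;; .push b true) ;; .pop a

/-- Move a list of numbers from stack `a` to both of the stacks `b` and `c`, reversing it. -/
def copyList (a b c : K) : Prog K :=
  .push b false ;; .push c false ;;
    .loop a isOne (.pop a ;; copyNum a b c ;; .push b true ;; .push c true) ;; .pop a

/-- Delete a list of numbers from stack `a`. -/
def dropList (a : K) : Prog K := .loop a isOne (.pop a ;; dropNum a) ;; .pop a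

/-- Remove the first number of the list on stack `a` and put it on stack `b`. -/
def takeHead (a b : K) : Prog K := .ite a isOne (.pop a ;; moveNum a b) (.push b false)

variable [DecidableEq K]

/-- `p` leads from `S` to `S'`. -/
def Leads (p : Prog K) (S S' : K → List Bool) : Prop := ∃ t, Runs p S t S'

theorem RunsIn.leads {p : Prog K} {S S' : K → List Bool} {T : ℕ} (h : RunsIn p S T S') :
    Leads p S S' := ⟨_, h.choose_spec.2⟩

theorem Leads.seq {p q : Prog K} {S S₁ S₂ : K → List Bool} (h₁ : Leads p S S₁)
    (h₂ : Leads q S₁ S₂) : Leads (p ;; q) S S₂ := ⟨_, h₁.choose_spec.seq h₂.choose_spec⟩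

theorem leads_push (k : K) (b : Bool) (S : K → List Bool) :
    Leads (.push k b) S (Function.update S k (b :: S k)) := ⟨_, .push k b S⟩

theorem leads_pop (k : K) (S : K → List Bool) :
    Leads (.pop k) S (Function.update S k (S k).tail) := ⟨_, .pop k S⟩

theorem Leads.loop_true {k : K} {c : Option Bool → Bool} {p : Prog K} {S S₁ S₂ : K → List Bool}
    (hc : c (S k).head? = true) (h₁ : Leads p S S₁) (h₂ : Leads (.loop k c p) S₁ S₂) :
    Leads (.loop k c p) S S₂ := ⟨_, .loop_true hc h₁.choose_spec h₂.choose_spec⟩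

theorem Leads.ite_true {k : K} {c : Option Bool → Bool} {p q : Prog K} {S S₁ : K → List Bool}
    (hc : c (S k).head? = true) (h : Leads p S S₁) : Leads (.ite k c p q) S S₁ :=
  ⟨_, .ite_true hc h.choose_spec⟩

theorem Leads.ite_false {k : K} {c : Option Bool → Bool} {p q : Prog K} {S S₁ : K → List Bool}
    (hc : c (S k).head? = false) (h : Leads q S S₁) : Leads (.ite k c p q) S S₁ :=
  ⟨_, .ite_false hc h.choose_spec⟩

theorem Leads.loop_false {k : K} {c : Option Bool → Bool} {p : Prog K} {S : K → List Bool}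
    (hc : c (S k).head? = false) : Leads (.loop k c p) S S := ⟨_, .loop_false hc⟩

end macros

/-! ### Running the codes of partial recursive functions -/

/-- Four stacks: a work stack, a store for numbers, a temporary stack and a stack of flags. -/
def quad (m s t c : List Bool) : Fin 4 → List Bool := ![m, s, t, c]

section quad

variable (m s t c x : List Bool)

@[simp] theorem quad_zero : quad m s t c 0 = m := rfl
@[simp] theorem quad_one : quad m s t c 1 = s := rfl
@[simp] theorem quad_two : quad m s t c 2 = t := rfl
@[simp] theorem quad_three : quad m s t c 3 = c := rfl

@[simp] theorem update_quad_zero : Function.update (quad m s t c) 0 x = quad x s t c := by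
  funext i; fin_cases i <;> rfl
@[simp] theorem update_quad_one : Function.update (quad m s t c) 1 x = quad m x t c := by
  funext i; fin_cases i <;> rfl
@[simp] theorem update_quad_two : Function.update (quad m s t c) 2 x = quad m s x c := by
  funext i; fin_cases i <;> rfl
@[simp] theorem update_quad_three : Function.update (quad m s t c) 3 x = quad m s t x := by
  funext i; fin_cases i <;> rfl

end quad

/-! ### Correctness of the moving programs. -/

section macros

variable {K : Type} [DecidableEq K]

theorem Leads.trans_eq {p : Prog K} {S S₁ S₂ : K → List Bool} (h : Leads p S S₁)
    (e : S₁ = S₂) : Leads p S S₂ := e ▸ h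

/-- Loop rule with an invariant: `I d n` are the stacks after `d` rounds with `n` rounds to go, and
the delimiter of the unary code ends the loop. -/
theorem leads_loop_encodeNat {a : K} {p : Prog K} (I : ℕ → ℕ → K → List Bool) (A : List Bool)
    (hI : ∀ d n, I d n a = encodeNat n ++ A) (hp : ∀ d n, Leads p (I d (n + 1)) (I (d + 1) n))
    (n : ℕ) : Leads (.loop a isOne p) (I 0 n) (I n 0) := by
  suffices ∀ n d, Leads (.loop a isOne p) (I d n) (I (d + n) 0) by simpa using this n 0
  intro n
  induction n with
  | zero => exact fun d => .loop_false (by simp [hI, encodeNat, isOne])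
  | succ n ih =>
    intro d
    refine .loop_true (by simp [hI, encodeNat, isOne]) (hp d n) ?_
    rw [← Nat.add_assoc, Nat.add_right_comm]
    exact ih (d + 1)

/-- Loop rule for lists: the processed entries `d` come in reverse order, as they do when they are
pushed on another stack. -/
theorem leads_loop_encodeList {α : Type} (e : α → List Bool) {a : K} {p : Prog K}
    (I : List α → List α → K → List Bool) (A : List Bool)
    (hI : ∀ d l, I d l a = encodeList e l ++ A)
    (hp : ∀ d x l, Leads p (I d (x :: l)) (I (x :: d) l))
    (l : List α) : Leads (.loop a isOne p) (I [] l) (I l.reverse []) := by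
  suffices ∀ l d, Leads (.loop a isOne p) (I d l) (I (l.reverse ++ d) []) by simpa using this l []
  intro l
  induction l with
  | nil => exact fun d => .loop_false (by simp [hI, encodeList, isOne])
  | cons x l ih =>
    intro d
    refine .loop_true (by simp [hI, encodeList, isOne]) (hp d x l) ?_
    simpa using ih (x :: d)

/-- The moving programs push the delimiter first and the ones on top of it, which gives a unary code
in its proper orientation again. -/
theorem replicate_append_encodeNat (n : ℕ) (A : List Bool) :
    List.replicate n true ++ false :: A = encodeNat n ++ A := by
  induction n with
  | zero => rfl
  | succ n ih => simp [List.replicate_succ, encodeNat, ih]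

theorem leads_moveNum {a b : K} (hab : a ≠ b) (n : ℕ) (A : List Bool) (S : K → List Bool)
    (h : S a = encodeNat n ++ A) :
    Leads (moveNum a b) S (Function.update (Function.update S a A) b (encodeNat n ++ S b)) := by
  have key := leads_loop_encodeNat (a := a) (p := .pop a ;; .push b true)
    (fun d n => Function.update (Function.update S a (encodeNat n ++ A)) b
      (List.replicate d true ++ false :: S b)) A (by simp [hab])
    (fun d n => ((leads_pop _ _).seq (leads_push _ _ _)).trans_eq (by
      funext j
      by_cases hb : j = b <;> by_cases ha : j = a <;>
        simp_all [encodeNat, List.replicate_succ])) n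
  refine ((leads_push _ _ _).trans_eq ?_).seq (key.seq ((leads_pop _ _).trans_eq ?_)) <;>
  · funext j
    by_cases hb : j = b <;> by_cases ha : j = a <;>
      simp_all [encodeNat, replicate_append_encodeNat]

theorem leads_copyNum {a b c : K} (hab : a ≠ b) (hac : a ≠ c) (hbc : b ≠ c) (n : ℕ)
    (A : List Bool) (S : K → List Bool) (h : S a = encodeNat n ++ A) :
    Leads (copyNum a b c) S (Function.update (Function.update (Function.update S a A)
      b (encodeNat n ++ S b)) c (encodeNat n ++ S c)) := by
  have key := leads_loop_encodeNat (a := a) (p := .pop a ;; .push b true ;; .push c true)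
    (fun d n => Function.update (Function.update (Function.update S a (encodeNat n ++ A)) b
      (List.replicate d true ++ false :: S b)) c (List.replicate d true ++ false :: S c)) A
    (by simp [hab, hac])
    (fun d n => ((leads_pop _ _).seq ((leads_push _ _ _).seq (leads_push _ _ _))).trans_eq (by
      funext j
      by_cases hc : j = c <;> by_cases hb : j = b <;> by_cases ha : j = a <;>
        simp_all [encodeNat, List.replicate_succ])) n
  refine (leads_push _ _ _).seq (((leads_push _ _ _).trans_eq ?_).seq
    (key.seq ((leads_pop _ _).trans_eq ?_))) <;>
  · funext j
    by_cases hc : j = c <;> by_cases hb : j = b <;> by_cases ha : j = a <;>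
      simp_all [encodeNat, replicate_append_encodeNat]

theorem leads_dropNum {a : K} (n : ℕ) (A : List Bool) (S : K → List Bool)
    (h : S a = encodeNat n ++ A) : Leads (dropNum a) S (Function.update S a A) := by
  have key := leads_loop_encodeNat (a := a) (p := .pop a)
    (fun _ n => Function.update S a (encodeNat n ++ A)) A (by simp)
    (fun d n => (leads_pop _ _).trans_eq (by simp [encodeNat])) n
  rw [← h, Function.update_eq_self] at key
  exact key.seq ((leads_pop _ _).trans_eq (by simp [encodeNat]))

theorem leads_moveList {a b : K} (hab : a ≠ b) (l : List ℕ) (A : List Bool) (S : K → List Bool)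
    (h : S a = encodeList encodeNat l ++ A) :
    Leads (moveList a b) S (Function.update (Function.update S a A) b
      (encodeList encodeNat l.reverse ++ S b)) := by
  have key := leads_loop_encodeList encodeNat (a := a)
    (p := .pop a ;; moveNum a b ;; .push b true)
    (fun d l => Function.update (Function.update S a (encodeList encodeNat l ++ A)) b
      (encodeList encodeNat d ++ S b)) A (by simp [hab])
    (fun d x l => ((leads_pop _ _).seq ((leads_moveNum hab x (encodeList encodeNat l ++ A) _
      (by simp [hab, encodeList])).seq (leads_push _ _ _))).trans_eq (by
      funext j
      by_cases hb : j = b <;> by_cases ha : j = a <;>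
        simp_all [encodeList])) l
  refine ((leads_push _ _ _).trans_eq ?_).seq (key.seq ((leads_pop _ _).trans_eq ?_)) <;>
  · funext j
    by_cases hb : j = b <;> by_cases ha : j = a <;> simp_all [encodeList]

theorem leads_copyList {a b c : K} (hab : a ≠ b) (hac : a ≠ c) (hbc : b ≠ c) (l : List ℕ)
    (A : List Bool) (S : K → List Bool) (h : S a = encodeList encodeNat l ++ A) :
    Leads (copyList a b c) S (Function.update (Function.update (Function.update S a A) b
      (encodeList encodeNat l.reverse ++ S b)) c (encodeList encodeNat l.reverse ++ S c)) := by
  have key := leads_loop_encodeList encodeNat (a := a)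
    (p := .pop a ;; copyNum a b c ;; .push b true ;; .push c true)
    (fun d l => Function.update (Function.update (Function.update S a
      (encodeList encodeNat l ++ A)) b (encodeList encodeNat d ++ S b)) c
      (encodeList encodeNat d ++ S c)) A (by simp [hab, hac])
    (fun d x l => ((leads_pop _ _).seq ((leads_copyNum hab hac hbc x
      (encodeList encodeNat l ++ A) _ (by simp [hab, hac, encodeList])).seq
        ((leads_push _ _ _).seq (leads_push _ _ _)))).trans_eq (by
      funext j
      by_cases hc : j = c <;> by_cases hb : j = b <;> by_cases ha : j = a <;>
        simp_all [encodeList])) l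
  refine (leads_push _ _ _).seq (((leads_push _ _ _).trans_eq ?_).seq
    (key.seq ((leads_pop _ _).trans_eq ?_))) <;>
  · funext j
    by_cases hc : j = c <;> by_cases hb : j = b <;> by_cases ha : j = a <;>
      simp_all [encodeList]

theorem leads_dropList {a : K} (l : List ℕ) (A : List Bool) (S : K → List Bool)
    (h : S a = encodeList encodeNat l ++ A) : Leads (dropList a) S (Function.update S a A) := by
  have key := leads_loop_encodeList encodeNat (a := a) (p := .pop a ;; dropNum a)
    (fun _ l => Function.update S a (encodeList encodeNat l ++ A)) A (by simp)
    (fun d x l => ((leads_pop _ _).seq (leads_dropNum x (encodeList encodeNat l ++ A) _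
      (by simp [encodeList]))).trans_eq (by simp)) l
  rw [← h, Function.update_eq_self] at key
  exact key.seq ((leads_pop _ _).trans_eq (by simp [encodeList]))

/-- An empty list yields `0` and stays empty, in accordance with the conventions `headI` and `tail`
in the semantics of codes. -/
theorem leads_takeHead {a b : K} (hab : a ≠ b) (l : List ℕ) (A : List Bool) (S : K → List Bool)
    (h : S a = encodeList encodeNat l ++ A) :
    Leads (takeHead a b) S (Function.update (Function.update S a
      (encodeList encodeNat l.tail ++ A)) b (encodeNat l.headI ++ S b)) := by
  cases l with
  | nil =>
    refine .ite_false (by simp [h, encodeList, isOne]) ((leads_push _ _ _).trans_eq ?_)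
    funext j
    by_cases hb : j = b <;> by_cases ha : j = a <;> simp_all [encodeNat, List.headI]
  | cons x l =>
    refine .ite_true (by simp [h, encodeList, isOne]) (((leads_pop _ _).seq
      (leads_moveNum hab x (encodeList encodeNat l ++ A) _ (by simp [h, encodeList]))).trans_eq ?_)
    funext j
    by_cases hb : j = b <;> by_cases ha : j = a <;> simp_all

end macros

/-- Duplicate the list on the work stack. -/
def dupList : Prog (Fin 4) :=
  moveList 0 2 ;; copyList 2 0 1 ;; moveList 1 2 ;; moveList 2 0

/-- The program that runs the code of a partial recursive function on the work stack. -/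
def ofCode : Code → Prog (Fin 4)
  | .zero' => .push 0 false ;; .push 0 true
  | .succ => takeHead 0 1 ;; dropList 0 ;; .push 0 false ;; moveNum 1 0 ;; .push 0 true ;;
      .push 0 true
  | .tail => takeHead 0 1 ;; dropNum 1
  | .cons f fs => dupList ;; ofCode f ;; takeHead 0 1 ;; dropList 0 ;; ofCode fs ;;
      moveNum 1 0 ;; .push 0 true
  | .comp f g => ofCode g ;; ofCode f
  | .case f g => takeHead 0 1 ;;
      .ite 1 isOne (.pop 1 ;; moveNum 1 0 ;; .push 0 true ;; ofCode g) (.pop 1 ;; ofCode f)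
  | .fix f => .push 3 true ;;
      .loop 3 isOne (.pop 3 ;; ofCode f ;; takeHead 0 1 ;;
        .ite 1 isOne (.push 3 true) (.push 3 false) ;; dropNum 1) ;; .pop 3

/-- Every transport reverses a list. Both copies undergo an even number of transports, two for one
copy and four for the other. -/
theorem leads_dupList (l : List ℕ) (A s t c : List Bool) :
    Leads dupList (quad (encodeList encodeNat l ++ A) s t c)
      (quad (encodeList encodeNat l ++ (encodeList encodeNat l ++ A)) s t c) := by
  refine (leads_moveList (by decide) l A _ (by simp)).seq ?_
  simp only [update_quad_zero, update_quad_two, quad_two]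
  refine (leads_copyList (by decide) (by decide) (by decide) l.reverse t _ (by simp)).seq ?_
  simp only [update_quad_zero, update_quad_two, quad_zero, update_quad_one, quad_one,
    List.reverse_reverse]
  refine (leads_moveList (by decide) l s _ (by simp)).seq ?_
  simp only [update_quad_two, quad_two, update_quad_one]
  refine (leads_moveList (by decide) l.reverse t _ (by simp)).trans_eq ?_
  simp

/-- Structural induction on the code. The words `A`, `s`, `t`, `u` below the active data are
arbitrary, so that a subprogram may run while pending numbers and loop flags are stored underneath.
-/
theorem leads_ofCode {c : Code} {v w : List ℕ} (h : w ∈ c.eval v) (A s t u : List Bool) :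
    Leads (ofCode c) (quad (encodeList encodeNat v ++ A) s t u)
      (quad (encodeList encodeNat w ++ A) s t u) := by
  have head : ∀ (v : List ℕ) (A s t u : List Bool),
      Leads (takeHead 0 1) (quad (encodeList encodeNat v ++ A) s t u)
        (quad (encodeList encodeNat v.tail ++ A) (encodeNat v.headI ++ s) t u) := fun v A s t u =>
    (leads_takeHead (by decide) v A _ (by simp)).trans_eq (by simp)
  have drop : ∀ (v : List ℕ) (A s t u : List Bool),
      Leads (dropList 0) (quad (encodeList encodeNat v ++ A) s t u) (quad A s t u) :=
    fun v A s t u => (leads_dropList v A _ (by simp)).trans_eq (by simp)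
  have back : ∀ (n : ℕ) (m s t u : List Bool),
      Leads (moveNum 1 0) (quad m (encodeNat n ++ s) t u) (quad (encodeNat n ++ m) s t u) :=
    fun n m s t u => (leads_moveNum (by decide) n s _ (by simp)).trans_eq (by simp)
  have drop1 : ∀ (n : ℕ) (m s t u : List Bool),
      Leads (dropNum 1) (quad m (encodeNat n ++ s) t u) (quad m s t u) :=
    fun n m s t u => (leads_dropNum n s _ (by simp)).trans_eq (by simp)
  induction c generalizing v w A s t u with
  | zero' =>
    obtain rfl : w = 0 :: v := by simpa using h
    exact (leads_push _ _ _).seq ((leads_push _ _ _).trans_eq (by simp [encodeList, encodeNat]))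
  | succ =>
    obtain rfl : w = [v.headI + 1] := by simpa using h
    refine (head _ _ _ _ _).seq ((drop _ _ _ _ _).seq ((leads_push _ _ _).seq ?_))
    simp only [update_quad_zero, quad_zero]
    exact (back _ _ _ _ _).seq ((leads_push _ _ _).seq ((leads_push _ _ _).trans_eq
      (by simp [encodeList, encodeNat])))
  | tail =>
    obtain rfl : w = v.tail := by simpa using h
    exact (head _ _ _ _ _).seq (drop1 _ _ _ _ _)
  | cons f fs ihf ihfs =>
    simp only [Code.cons_eval, Part.bind_eq_bind, Part.mem_bind_iff] at h
    obtain ⟨x, hx, y, hy, h⟩ := h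
    obtain rfl : w = x.headI :: y := by simpa using h
    refine (leads_dupList _ _ _ _ _).seq ((ihf hx _ _ _ _).seq ((head _ _ _ _ _).seq
      ((drop _ _ _ _ _).seq ((ihfs hy _ _ _ _).seq ((back _ _ _ _ _).seq
        ((leads_push _ _ _).trans_eq ?_))))))
    simp [encodeList]
  | comp f g ihf ihg =>
    rw [Code.comp_eval] at h
    obtain ⟨x, hx, h⟩ := Part.mem_bind_iff.1 h
    exact (ihg hx _ _ _ _).seq (ihf h _ _ _ _)
  | case f g ihf ihg =>
    simp only [Code.case_eval] at h
    refine (head _ _ _ _ _).seq ?_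
    cases hv : v.headI with
    | zero =>
      rw [hv] at h
      refine .ite_false rfl ((leads_pop _ _).seq ?_)
      simpa [encodeNat] using ihf h A s t u
    | succ n =>
      rw [hv] at h
      refine .ite_true rfl ((leads_pop _ _).seq ?_)
      simp only [quad_one, encodeNat, List.cons_append, List.tail_cons, update_quad_one]
      refine (back _ _ _ _ _).seq ((leads_push _ _ _).seq ?_)
      simpa [encodeList] using ihg h A s t u
  | fix f ih =>
    simp only [Code.fix_eval] at h
    -- The flag on stack 3 records whether the head of the last result was nonzero, which is the
    -- condition under which `fix` goes on.
    have key : Leads (.loop 3 isOne (.pop 3 ;; ofCode f ;; takeHead 0 1 ;;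
        .ite 1 isOne (.push 3 true) (.push 3 false) ;; dropNum 1))
        (quad (encodeList encodeNat v ++ A) s t (true :: u))
        (quad (encodeList encodeNat w ++ A) s t (false :: u)) := by
      refine PFun.fixInduction' h ?_ ?_
      · intro v hv
        simp only [Part.mem_map_iff] at hv
        obtain ⟨x, hx, hv⟩ := hv
        split_ifs at hv with h0
        obtain rfl := Sum.inl.inj hv
        refine .loop_true (S₁ := quad (encodeList encodeNat x.tail ++ A) s t (false :: u)) rfl
          ((leads_pop _ _).seq ?_) (.loop_false rfl)
        simp only [quad_three, List.tail_cons, update_quad_three]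
        refine (ih hx _ _ _ _).seq ((head _ _ _ _ _).seq ?_)
        rw [h0]
        refine Leads.seq (.ite_false rfl (leads_push _ _ _)) ?_
        simp only [quad_three, update_quad_three]
        exact drop1 _ _ _ _ _
      · intro v v' _ hv hloop
        simp only [Part.mem_map_iff] at hv
        obtain ⟨x, hx, hv⟩ := hv
        split_ifs at hv with h0
        obtain rfl := Sum.inr.inj hv
        refine .loop_true rfl ((leads_pop _ _).seq ?_) hloop
        simp only [quad_three, List.tail_cons, update_quad_three]
        refine (ih hx _ _ _ _).seq ((head _ _ _ _ _).seq ?_)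
        obtain ⟨n, hn⟩ := Nat.exists_eq_succ_of_ne_zero h0
        rw [hn]
        refine Leads.seq (.ite_true rfl (leads_push _ _ _)) ?_
        simp only [quad_three, update_quad_three]
        exact drop1 _ _ _ _ _
    refine (leads_push _ _ _).seq ?_
    simp only [quad_three, update_quad_three]
    exact key.seq ((leads_pop _ _).trans_eq (by simp))

/-! ### Programs for computable lists of bits -/

/-- Codes are available for numerical functions, here the length of `F k` and its n-th entry. A
`fix` loop assembles the list from them, counting the index down and prepending one entry per round.
-/
theorem exists_code_list {F : ℕ → List ℕ} (hF : Computable F) :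
    ∃ c : Code, ∀ k, F k ∈ c.eval [k] := by
  have hlen : Computable fun k => (F k).length := Computable.list_length.comp hF
  have hget : Computable₂ fun n k => (F k).getD n 0 :=
    (Primrec.list_getD 0).to_comp.comp (hF.comp Computable.snd) Computable.fst
  obtain ⟨cl, hcl⟩ := Code.exists_code (Nat.Partrec'.part_iff₁.2 hlen.partrec)
  obtain ⟨cq, hcq⟩ := Code.exists_code (Nat.Partrec'.part_iff₂.2 hget.partrec₂)
  have hcl' : ∀ k, cl.eval [k] = Part.some [(F k).length] := fun k => by
    simpa [List.Vector.head] using hcl ⟨[k], rfl⟩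
  have hcq' : ∀ n k, cq.eval [n, k] = Part.some [(F k).getD n 0] := fun n k => by
    simpa [List.Vector.head, List.Vector.tail] using hcq ⟨[n, k], rfl⟩
  let query : Code := cq.comp (.cons .id (.cons .tail .nil))
  -- On the state `j :: k :: out`, the leading `0` or `1` of the result tells `fix` to stop with
  -- `out` or to continue with the rest.
  let body : Code := .case (Code.zero'.comp .tail)
    (.cons (Code.succ.comp .zero') (.cons .id (.cons .tail (.cons query (Code.tail.comp .tail)))))
  have hbody0 : ∀ k out, body.eval (0 :: k :: out) = Part.some (0 :: out) := by
    intro k out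
    simp [body]
  have hbody1 : ∀ n k out, body.eval ((n + 1) :: k :: out) =
      Part.some (1 :: n :: k :: (F k).getD n 0 :: out) := by
    intro n k out
    have hbind : (Part.some [n, k] >>= cq.eval) = cq.eval [n, k] := Part.bind_some _ _
    simp [body, query, hbind, hcq']
  refine ⟨body.fix.comp (.cons cl .id), fun k => ?_⟩
  -- Loop invariant: the entries from index `j` on have been collected.
  have key : ∀ j ≤ (F k).length, F k ∈ body.fix.eval (j :: k :: (F k).drop j) := by
    intro j
    induction j with
    | zero =>
      intro _
      rw [Code.fix_eval]
      exact PFun.mem_fix_iff.2 (Or.inl (by simp [hbody0]))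
    | succ j ih =>
      intro hj
      have := ih (by omega)
      rw [Code.fix_eval] at this ⊢
      refine PFun.mem_fix_iff.2 (Or.inr ⟨_, ?_, this⟩)
      rw [List.drop_eq_getElem_cons hj]
      simp [hbody1, List.getElem?_eq_getElem (show j < (F k).length from hj)]
  rw [Code.comp_eval]
  exact Part.mem_bind_iff.2 ⟨[(F k).length, k], by simp [hcl'], by simpa using key _ le_rfl⟩

/-- Turn a list of numbers, each of them `0` or `1`, on the work stack into a list of bits on the
next stack, reversing it. -/
def unpackBits : Prog (Fin 4) :=
  .loop 0 isOne (.pop 0 ;;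
    .ite 0 isOne (.pop 0 ;; .pop 0 ;; .push 1 true) (.pop 0 ;; .push 1 false)) ;; .pop 0

theorem leads_unpackBits (l : List Bool) :
    Leads unpackBits (quad (encodeList encodeNat (l.map Bool.toNat)) [] [] [])
      (quad [] l.reverse [] []) := by
  have key := leads_loop_encodeList (fun b : Bool => encodeNat b.toNat) (a := (0 : Fin 4))
    (p := .pop 0 ;;
      .ite 0 isOne (.pop 0 ;; .pop 0 ;; .push 1 true) (.pop 0 ;; .push 1 false))
    (fun d l => quad (encodeList (fun b : Bool => encodeNat b.toNat) l) d [] []) []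
    (by simp) ?_ l
  · have hl : ∀ l : List Bool, encodeList encodeNat (l.map Bool.toNat) =
        encodeList (fun b : Bool => encodeNat b.toNat) l := by
      intro l
      induction l with
      | nil => rfl
      | cons b l ih => simp [encodeList, ih]
    rw [hl]
    exact key.seq ((leads_pop _ _).trans_eq (by simp [encodeList]))
  · intro d b l
    refine (leads_pop _ _).seq ?_
    cases b
    · exact .ite_false rfl ((leads_pop _ _).seq
        ((leads_push _ _ _).trans_eq (by simp [encodeList, encodeNat])))
    · exact .ite_true rfl ((leads_pop _ _).seq ((leads_pop _ _).seq
        ((leads_push _ _ _).trans_eq (by simp [encodeList, encodeNat]))))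

theorem primrec_encodeNat : Primrec encodeNat := by
  have h : Primrec fun n : ℕ => (n.rec [false] fun _ l => true :: l : List Bool) :=
    Primrec.nat_rec₁ _ (Primrec.list_cons.comp (Primrec.const true) Primrec.snd)
  exact h.of_eq fun n => by
    induction n with
    | zero => rfl
    | succ n ih => simp only [encodeNat, ← ih]

/-- Termination on every `k` suffices: the step count is then total, and `computable_time` makes it
computable without any analysis of the program. -/
theorem exists_table_prog {F : ℕ → List Bool} (hF : Computable F) :
    ∃ (p : Prog (Fin 4)) (t : ℕ → ℕ), Computable t ∧
      ∀ k, Runs p (quad (encodeList encodeNat [k]) [] [] []) (t k) (quad [] (F k) [] []) := by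
  -- The reversal here is undone by `unpackBits`.
  obtain ⟨c, hc⟩ := exists_code_list (F := fun k => (F k).reverse.map Bool.toNat)
    ((Primrec.list_map Primrec.list_reverse
      ((Primrec.dom_finite Bool.toNat).comp Primrec.snd).to₂).to_comp.comp hF)
  have h : ∀ k, Leads (ofCode c ;; unpackBits) (quad (encodeList encodeNat [k]) [] [] [])
      (quad [] (F k) [] []) := fun k => by
    refine Leads.seq ?_ ((leads_unpackBits (F k).reverse).trans_eq (by simp))
    simpa using leads_ofCode (hc k) [] [] [] []
  choose t ht using h
  refine ⟨_, t, computable_time ?_ ht, ht⟩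
  refine Primrec.to_comp (Primrec.fin_curry.2 ?_)
  have : Primrec fun a : ℕ × Fin 4 =>
      if a.2 = 0 then true :: (encodeNat a.1 ++ [false]) else [] :=
    Primrec.ite (Primrec.eq.comp Primrec.snd (Primrec.const 0))
      (Primrec.list_cons.comp (Primrec.const true)
        (Primrec.list_append.comp (primrec_encodeNat.comp Primrec.fst) (Primrec.const [false])))
      (Primrec.const [])
  refine this.of_eq ?_
  rintro ⟨k, i⟩
  fin_cases i <;> rfl

end Prog

namespace SigmaRho

open ParamComplexity

/-! ### The constraints on the relation of a vertex to the chosen vertices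

With respect to a vertex `v`, a choice of a vertex (or of none) is of one of three kinds: it is `v`
itself (kind `0`), it is a neighbour of `v` (kind `1`), or neither (kind `2`). A mask is a set of
kinds; a template is a list of masks, one for each of the `k` choices. -/

/-- The binary code of a mask. -/
def encodeMask (m : Fin 3 → Bool) : List Bool := [m 0, m 1, m 2]

/-- All sequences of `k` kinds. -/
def patterns : ℕ → List (List (Fin 3))
  | 0 => [[]]
  | k + 1 => (patterns k).flatMap fun b => [0 :: b, 1 :: b, 2 :: b]

theorem mem_patterns {k : ℕ} {b : List (Fin 3)} : b ∈ patterns k ↔ b.length = k := by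
  induction k generalizing b with
  | zero => simp [patterns]
  | succ k ih =>
    simp only [patterns, List.mem_flatMap, ih]
    constructor
    · rintro ⟨l, rfl, h⟩
      simp only [List.mem_cons, List.not_mem_nil, or_false] at h
      rcases h with rfl | rfl | rfl <;> simp
    · intro h
      obtain ⟨τ, l, rfl⟩ := List.exists_cons_of_length_eq_add_one h
      refine ⟨l, by simpa using h, ?_⟩
      fin_cases τ <;> simp

/-- A vertex may see the pattern `b` of choices; `s` and `r` are the first values of the
characteristic functions of `σ` and `ρ`. -/
def allowed (s r : List Bool) (b : List (Fin 3)) : Bool :=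
  if b.count 0 = 0 then r.getD (b.count 1) false
  else if b.count 0 = 1 then s.getD (b.count 1) false else false

/-- The template that rules out the pattern `b`. -/
def avoid (b : List (Fin 3)) : List (Fin 3 → Bool) := b.map fun τ κ => decide (κ ≠ τ)

/-- The template that demands that the `i`-th choice is made. -/
def demand (k i : ℕ) : List (Fin 3 → Bool) := (List.range k).map fun j _ => decide (j = i)

/-- The templates that express that all the choices are made and that no vertex sees a pattern that
is not allowed. -/
def templatesOf (s r : List Bool) (k : ℕ) : List (List (Fin 3 → Bool)) :=
  (List.range k).map (demand k) ++
    (patterns k).filterMap fun b => if allowed s r b then none else some (avoid b)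

/-- The first `k + 1` values of a function. -/
def table (χ : ℕ → Bool) (k : ℕ) : List Bool := (List.range (k + 1)).map χ

/-- The templates for the sets with the characteristic functions `χσ` and `χρ`. -/
def templates (χσ χρ : ℕ → Bool) (k : ℕ) : List (List (Fin 3 → Bool)) :=
  templatesOf (table χσ k) (table χρ k) k

/-- The templates as a binary word. -/
def templateBits (χσ χρ : ℕ → Bool) (k : ℕ) : List Bool :=
  (templates χσ χρ k).flatMap (encodeList encodeMask)

/-! ### Computability of the templates. -/

theorem encodeList_eq_flatMap {α : Type} (e : α → List Bool) (l : List α) :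
    encodeList e l = (l.flatMap fun a => true :: e a) ++ [false] := by
  induction l with
  | nil => rfl
  | cons a l ih => simp [encodeList, ih]

theorem primrec_patterns : Primrec patterns := by
  have h : Primrec fun k : ℕ => (k.rec [[]] fun _ L =>
      L.flatMap fun b => [0 :: b, 1 :: b, 2 :: b] : List (List (Fin 3))) := by
    refine Primrec.nat_rec₁ _ (Primrec.list_flatMap Primrec.snd ?_)
    have hc : ∀ τ : Fin 3, Primrec fun a : (ℕ × List (List (Fin 3))) × List (Fin 3) => τ :: a.2 :=
      fun τ => Primrec.list_cons.comp (Primrec.const τ) Primrec.snd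
    exact Primrec.list_cons.comp (hc 0) (Primrec.list_cons.comp (hc 1)
      (Primrec.list_cons.comp (hc 2) (Primrec.const [])))
  exact h.of_eq fun k => by
    induction k with
    | zero => rfl
    | succ k ih => simp only [patterns, ← ih]

theorem primrec_count (τ : Fin 3) : Primrec fun b : List (Fin 3) => b.count τ := by
  have h : Primrec fun b : List (Fin 3) => (b.filter fun x => decide (x = τ)).length :=
    Primrec.list_length.comp (Primrec.listFilter (Primrec.eq.comp Primrec.id (Primrec.const τ)))
  exact h.of_eq fun b => by
    rw [List.count_eq_countP, List.countP_eq_length_filter]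
    congr 2

theorem primrec_avoid : Primrec avoid := by
  have h : Primrec fun τ : Fin 3 => (fun τ' => decide (τ' ≠ τ) : Fin 3 → Bool) :=
    Primrec.dom_finite _
  have h₂ : Primrec₂ fun (_ : List (Fin 3)) (τ : Fin 3) =>
      (fun τ' => decide (τ' ≠ τ) : Fin 3 → Bool) := h.comp Primrec.snd
  exact Primrec.list_map Primrec.id h₂

/-- The characteristic functions enter as finite tables, so everything beyond the tables is
primitive recursive. -/
theorem primrec_templatesOf : Primrec fun a : (List Bool × List Bool) × ℕ =>
    templatesOf a.1.1 a.1.2 a.2 := by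
  refine Primrec.list_append.comp ?_ ?_
  · refine Primrec.list_map (Primrec.list_range.comp Primrec.snd) ?_
    refine Primrec.list_map (Primrec.list_range.comp (Primrec.snd.comp Primrec.fst)) ?_
    refine Primrec.fin_curry.2 ?_
    have := (Primrec.eq (α := ℕ)).decide.comp
      (Primrec.snd.comp (Primrec.fst (α := ((((List Bool × List Bool) × ℕ) × ℕ) × ℕ)) (β := Fin 3)))
      (Primrec.snd.comp (Primrec.fst.comp Primrec.fst))
    exact this
  · refine Primrec.listFilterMap (primrec_patterns.comp Primrec.snd) ?_
    have c : ∀ τ, Primrec fun a : ((List Bool × List Bool) × ℕ) × List (Fin 3) =>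
      a.2.count τ := fun τ => (primrec_count τ).comp Primrec.snd
    have hallowed : Primrec fun a : ((List Bool × List Bool) × ℕ) × List (Fin 3) =>
        allowed a.1.1.1 a.1.1.2 a.2 :=
      Primrec.ite (Primrec.eq.comp (c 0) (Primrec.const 0))
        ((Primrec.list_getD false).comp (Primrec.snd.comp (Primrec.fst.comp Primrec.fst)) (c 1))
        (Primrec.ite (Primrec.eq.comp (c 0) (Primrec.const 1))
          ((Primrec.list_getD false).comp (Primrec.fst.comp (Primrec.fst.comp Primrec.fst)) (c 1))
          (Primrec.const false))
    refine Primrec.ite (Primrec.eq.comp hallowed (Primrec.const true)) (Primrec.const none)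
      (Primrec.option_some.comp ?_)
    exact primrec_avoid.comp Primrec.snd

theorem computable_table {χ : ℕ → Bool} (hχ : Computable χ) : Computable (table χ) := by
  have hstep : Computable₂ fun (_ : ℕ) (a : ℕ × List Bool) => a.2 ++ [χ a.1] :=
    Computable.list_concat.comp (Computable.snd.comp Computable.snd)
      (hχ.comp (Computable.fst.comp Computable.snd))
  have h := Computable.nat_rec Computable.succ (Computable.const ([] : List Bool)) hstep
  refine h.of_eq fun k => ?_
  rw [table, ← Nat.succ_eq_add_one]
  generalize k.succ = m
  induction m with
  | zero => rfl
  | succ m ih => simp only [List.range_succ, List.map_append, ← ih, List.map_cons, List.map_nil]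

theorem computable_templateBits {χσ χρ : ℕ → Bool} (hσ : Computable χσ) (hρ : Computable χρ) :
    Computable (templateBits χσ χρ) := by
  have hmask : Primrec fun m : Fin 3 → Bool => true :: encodeMask m := Primrec.dom_finite _
  have henc : Primrec (encodeList encodeMask) := by
    have : Primrec fun l : List (Fin 3 → Bool) =>
        (l.flatMap fun m => true :: encodeMask m) ++ [false] :=
      Primrec.list_append.comp (Primrec.list_flatMap Primrec.id (hmask.comp Primrec.snd).to₂)
        (Primrec.const [false])
    exact this.of_eq fun l => (encodeList_eq_flatMap _ l).symm
  have henc₂ : Primrec₂ fun (_ : (List Bool × List Bool) × ℕ) (l : List (Fin 3 → Bool)) =>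
      encodeList encodeMask l := henc.comp Primrec.snd
  have h : Primrec fun a : (List Bool × List Bool) × ℕ =>
      (templatesOf a.1.1 a.1.2 a.2).flatMap (encodeList encodeMask) :=
    Primrec.list_flatMap primrec_templatesOf henc₂
  exact h.to_comp.comp (Computable.pair
    (Computable.pair (computable_table hσ) (computable_table hρ)) Computable.id)

/-! ### Monotone formulas in conjunctive normal form as circuits -/

/-- The clauses read input nodes only, and these keep their places at the front while values are
appended; hence the gates do not influence each other. A general `step` serves evaluation, depth and
weft at once. -/
theorem runGates_map_or {β : Type} [Inhabited β] {step : (ℕ → β) → Gate → β}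
    (hstep : ∀ v w g, (∀ a ∈ g.args, v a = w a) → step v g = step w g)
    (vals : List β) (cls : List (List ℕ)) (h : ∀ cl ∈ cls, ∀ a ∈ cl, a < vals.length)
    (w : List β) (gs : List Gate) :
    runGates step (vals ++ w) (cls.map Gate.or ++ gs) =
      runGates step (vals ++ (w ++ cls.map fun cl => step (fun i => vals.getD i default) (.or cl)))
        gs := by
  induction cls generalizing w with
  | nil => simp
  | cons cl cls ih =>
    have hcl : step (fun i => (vals ++ w).getD i default) (.or cl) =
        step (fun i => vals.getD i default) (.or cl) := by
      refine hstep _ _ _ fun a ha => ?_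
      have ha : a < vals.length := h cl (by simp) a ha
      simp [List.getElem?_append_left ha]
    simp only [List.map_cons, List.cons_append, runGates]
    rw [hcl, List.append_assoc, ih (fun c hc => h c (by simp [hc]))]
    simp

theorem maxArg_le {d : ℕ → ℕ} {g : Gate} {B : ℕ} (h : ∀ a ∈ g.args, d a ≤ B) :
    g.maxArg d ≤ B := by
  unfold Gate.maxArg
  generalize g.args = l at h
  induction l with
  | nil => simp
  | cons a l ih =>
    simp only [List.map_cons, List.foldr_cons, max_le_iff]
    exact ⟨h a (by simp), ih fun b hb => h b (by simp [hb])⟩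

theorem maxArg_congr {v w : ℕ → ℕ} {g : Gate} (h : ∀ a ∈ g.args, v a = w a) :
    g.maxArg v = g.maxArg w := by
  unfold Gate.maxArg
  rw [List.map_congr_left h]

theorem gateEval_congr {v w : ℕ → Bool} {g : Gate} (h : ∀ a ∈ g.args, v a = w a) :
    g.eval v = g.eval w := by
  rw [Bool.eq_iff_iff]
  cases g with
  | not a => simp [Gate.eval, h a (by simp [Gate.args])]
  | and as =>
    simp only [Gate.eval, List.all_eq_true]
    exact forall₂_congr fun a ha => by rw [h a ha]
  | or as =>
    simp only [Gate.eval, List.any_eq_true]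
    exact exists_congr fun a => and_congr_right fun ha => by rw [h a ha]

/-- The circuit of the conjunction of the clauses `cls` in the variables below `N`. -/
def cnfCircuit (N : ℕ) (cls : List (List ℕ)) (h : ∀ cl ∈ cls, ∀ a ∈ cl, a < N) : Circuit where
  numInputs := N
  gates := cls.map Gate.or ++ [Gate.and (List.range' N cls.length)]
  output := N + cls.length
  args_lt := by
    intro i hi a ha
    by_cases hi' : i < cls.length
    · rw [List.getElem_append_left (by simpa using hi'), List.getElem_map] at ha
      exact (h _ (List.getElem_mem _) a ha).trans_le (Nat.le_add_right _ _)
    · obtain rfl : i = cls.length := by simp at hi; omega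
      rw [List.getElem_append_right (by simp)] at ha
      simp only [List.length_map, Nat.sub_self, List.getElem_cons_zero, Gate.args,
        List.mem_range'_1] at ha
      exact ha.2
  output_lt := by simp

theorem getD_runGates_cnf {β : Type} [Inhabited β] {step : (ℕ → β) → Gate → β}
    (hstep : ∀ v w g, (∀ a ∈ g.args, v a = w a) → step v g = step w g)
    (vals : List β) (cls : List (List ℕ)) (h : ∀ cl ∈ cls, ∀ a ∈ cl, a < vals.length) (d : β) :
    (runGates step vals (cls.map Gate.or ++ [Gate.and (List.range' vals.length cls.length)])).getD
      (vals.length + cls.length) d =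
    step (fun i => (vals ++ cls.map fun cl =>
      step (fun i => vals.getD i default) (.or cl)).getD i default)
      (Gate.and (List.range' vals.length cls.length)) := by
  have := runGates_map_or hstep vals cls h [] [Gate.and (List.range' vals.length cls.length)]
  rw [List.append_nil, List.nil_append] at this
  rw [this]
  simp only [runGates]
  rw [List.getD_append_right _ _ _ _ (by simp)]
  simp

theorem cnfCircuit_depth_le {N : ℕ} {cls : List (List ℕ)} (h : ∀ cl ∈ cls, ∀ a ∈ cl, a < N) :
    (cnfCircuit N cls h).depth ≤ 2 := by
  have key := getD_runGates_cnf (step := fun d g => 1 + g.maxArg d)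
    (fun v w g e => by rw [maxArg_congr e]) (List.replicate N 0) cls (by simpa using h) 0
  simp only [List.length_replicate] at key
  simp only [Circuit.depth, cnfCircuit]
  rw [key]
  refine Nat.add_le_add_left (m := 1) (maxArg_le fun a ha => ?_) 1
  rw [Gate.args, List.mem_range'_1] at ha
  rw [List.getD_append_right _ _ _ _ (by simpa using ha.1), List.getD_eq_getElem _ _
    (by simp; omega), List.getElem_map]
  -- Inputs have depth `0`, which is also the default value beyond the list.
  exact Nat.add_le_add_left (maxArg_le (B := 0) fun b _ => by
    rcases lt_or_ge b N with hb | hb <;> simp [hb]) 1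

theorem cnfCircuit_weft_le {N : ℕ} {cls : List (List ℕ)} (h : ∀ cl ∈ cls, ∀ a ∈ cl, a < N) :
    (cnfCircuit N cls h).weft ≤ 2 := by
  have key := getD_runGates_cnf (step := fun d g => (if g.isLarge then 1 else 0) + g.maxArg d)
    (fun v w g e => by rw [maxArg_congr e]) (List.replicate N 0) cls (by simpa using h) 0
  simp only [List.length_replicate] at key
  simp only [Circuit.weft, cnfCircuit]
  rw [key]
  -- On each of the two levels a gate counts at most once, whatever its fan-in.
  have large : ∀ g : Gate, (if g.isLarge = true then 1 else 0) ≤ 1 := fun g => by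
    split_ifs <;> simp
  refine Nat.add_le_add (b := 1) (d := 1) (large _) (maxArg_le fun a ha => ?_)
  rw [Gate.args, List.mem_range'_1] at ha
  rw [List.getD_append_right _ _ _ _ (by simpa using ha.1), List.getD_eq_getElem _ _
    (by simp; omega), List.getElem_map]
  exact Nat.add_le_add (b := 1) (d := 0) (large _) (maxArg_le fun b _ => by
    rcases lt_or_ge b N with hb | hb <;> simp [hb])

theorem cnfCircuit_eval {N : ℕ} {cls : List (List ℕ)} (h : ∀ cl ∈ cls, ∀ a ∈ cl, a < N)
    (x : Fin N → Bool) : (cnfCircuit N cls h).eval x = true ↔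
      ∀ cl ∈ cls, ∃ a : Fin N, (a : ℕ) ∈ cl ∧ x a = true := by
  have key := getD_runGates_cnf (step := Gate.eval)
    (fun v w g e => gateEval_congr e) (List.ofFn x) cls (by simpa using h) false
  simp only [List.length_ofFn] at key
  have hor : ∀ cl ∈ cls, (Gate.eval (fun i => (List.ofFn x).getD i default) (.or cl) = true ↔
      ∃ a : Fin N, (a : ℕ) ∈ cl ∧ x a = true) := by
    intro cl hcl
    simp only [Gate.eval, List.any_eq_true]
    constructor
    · rintro ⟨a, ha, hx⟩
      have haN := h cl hcl a ha
      exact ⟨⟨a, haN⟩, ha, by simpa [haN] using hx⟩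
    · rintro ⟨a, ha, hx⟩
      exact ⟨a, ha, by simpa using hx⟩
  unfold Circuit.eval
  change (runGates Gate.eval (List.ofFn x) (cls.map Gate.or ++
    [Gate.and (List.range' N cls.length)])).getD (N + cls.length) false = true ↔ _
  rw [key]
  simp only [Gate.eval, List.all_eq_true, List.mem_range'_1]
  constructor
  · intro hall cl hcl
    obtain ⟨i, hi, rfl⟩ := List.mem_iff_getElem.1 hcl
    have := hall (N + i) (by omega)
    rw [List.getD_append_right _ _ _ _ (by simp), List.getD_eq_getElem _ _ (by simpa using hi),
      List.getElem_map] at this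
    refine (hor _ hcl).1 ?_
    simpa [Gate.eval] using this
  · intro hall a ha
    rw [List.getD_append_right _ _ _ _ (by simpa using ha.1), List.getD_eq_getElem _ _
      (by simp; omega), List.getElem_map]
    exact (hor _ (List.getElem_mem _)).2 (hall _ (List.getElem_mem _))

/-! ### The reduction -/

/-- The variables of one column that a template selects: the column has the kind `τ`, and its
variables are numbered from `c` on. -/
def slotArgs (τ : Fin 3) : ℕ → List (Fin 3 → Bool) → List ℕ
  | _, [] => []
  | c, m :: ms => if m τ then c :: slotArgs τ (c + 1) ms else slotArgs τ (c + 1) ms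

/-- The variables that a template selects, given the kinds of the columns. -/
def clauseArgs (tpl : List (Fin 3 → Bool)) : ℕ → List (Fin 3) → List ℕ
  | _, [] => []
  | c, τ :: row => slotArgs τ c tpl ++ clauseArgs tpl (c + tpl.length) row

/-- The clauses given by all templates and rows. -/
def clauses (tpls : List (List (Fin 3 → Bool))) (rows : List (List (Fin 3))) : List (List ℕ) :=
  tpls.flatMap fun tpl => rows.map (clauseArgs tpl 0)

theorem mem_slotArgs {τ : Fin 3} {c a : ℕ} {tpl : List (Fin 3 → Bool)} :
    a ∈ slotArgs τ c tpl ↔ ∃ i m, tpl[i]? = some m ∧ m τ = true ∧ a = c + i := by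
  induction tpl generalizing c with
  | nil => simp [slotArgs]
  | cons m ms ih =>
    have hs : a ∈ slotArgs τ c (m :: ms) ↔ (m τ = true ∧ a = c) ∨ a ∈ slotArgs τ (c + 1) ms := by
      by_cases h : m τ = true <;> simp [slotArgs, h]
    rw [hs, ih]
    constructor
    · rintro (⟨h, rfl⟩ | ⟨i, m', h₁, h₂, rfl⟩)
      · exact ⟨0, m, by simp, h, by simp⟩
      · exact ⟨i + 1, m', by simpa using h₁, h₂, by omega⟩
    · rintro ⟨_ | i, m', h₁, h₂, rfl⟩
      · simp only [List.getElem?_cons_zero, Option.some.injEq] at h₁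
        exact Or.inl ⟨h₁ ▸ h₂, rfl⟩
      · exact Or.inr ⟨i, m', by simpa using h₁, h₂, by omega⟩

/-- The variables are numbered column by column. For `c = 0` the number `i + tpl.length * p` is the
value of `finProdFinEquiv (p, i)`. -/
theorem mem_clauseArgs {tpl : List (Fin 3 → Bool)} {c a : ℕ} {row : List (Fin 3)} :
    a ∈ clauseArgs tpl c row ↔ ∃ p i τ m, row[p]? = some τ ∧ tpl[i]? = some m ∧ m τ = true ∧
      a = c + (i + tpl.length * p) := by
  induction row generalizing c with
  | nil => simp [clauseArgs]
  | cons τ row ih =>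
    rw [clauseArgs, List.mem_append, ih, mem_slotArgs]
    constructor
    · rintro (⟨i, m, h₁, h₂, rfl⟩ | ⟨p, i, τ', m, h₁, h₂, h₃, rfl⟩)
      · exact ⟨0, i, τ, m, by simp, h₁, h₂, by simp⟩
      · exact ⟨p + 1, i, τ', m, by simpa using h₁, h₂, h₃, by ring⟩
    · rintro ⟨_ | p, i, τ', m, h₁, h₂, h₃, rfl⟩
      · simp only [List.getElem?_cons_zero, Option.some.injEq] at h₁
        exact Or.inl ⟨i, m, h₂, h₁ ▸ h₃, by simp⟩
      · exact Or.inr ⟨p, i, τ', m, by simpa using h₁, h₂, h₃, by ring⟩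

open Classical in
/-- The kind of a choice with respect to the vertex `v`; the choice `n` stands for no vertex. -/
noncomputable def kind {n : ℕ} (G : SimpleGraph (Fin n)) (v : Fin n) (p : Fin (n + 1)) : Fin 3 :=
  if p = v.castSucc then 0 else if ∃ u, p = u.castSucc ∧ G.Adj v u then 1 else 2

/-- The kinds of all choices with respect to the vertices, one after the other. -/
noncomputable def rows {n : ℕ} (G : SimpleGraph (Fin n)) : List (List (Fin 3)) :=
  (List.finRange n).map fun v => List.ofFn (kind G v)

theorem length_of_mem_templatesOf {s r : List Bool} {k : ℕ} {tpl : List (Fin 3 → Bool)}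
    (h : tpl ∈ templatesOf s r k) : tpl.length = k := by
  simp only [templatesOf, List.mem_append, List.mem_map, List.mem_filterMap] at h
  rcases h with ⟨i, -, rfl⟩ | ⟨b, hb, h⟩
  · simp [demand]
  · split_ifs at h
    obtain rfl := Option.some.inj h
    simpa [avoid] using mem_patterns.1 hb

theorem lt_of_mem_clauses {s r : List Bool} {k n : ℕ} {G : SimpleGraph (Fin n)} :
    ∀ cl ∈ clauses (templatesOf s r k) (rows G), ∀ a ∈ cl, a < (n + 1) * k := by
  intro cl hcl a ha
  simp only [clauses, rows, List.mem_flatMap, List.mem_map] at hcl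
  obtain ⟨tpl, htpl, row, ⟨v, -, rfl⟩, rfl⟩ := hcl
  obtain ⟨p, i, τ, m, hp, hi, -, rfl⟩ := mem_clauseArgs.1 ha
  have hk := length_of_mem_templatesOf htpl
  have hp := (List.getElem?_eq_some_iff.1 hp).1
  have hi := (List.getElem?_eq_some_iff.1 hi).1
  rw [List.length_ofFn] at hp
  rw [hk] at hi ⊢
  calc 0 + (i + k * p) < k + k * p := by omega
    _ = (p + 1) * k := by ring
    _ ≤ (n + 1) * k := Nat.mul_le_mul_right k hp

/-! ### Satisfying inputs of weight k as sequences of choices. -/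

theorem getElem_demand {k i j : ℕ} (h : j < (demand k i).length) :
    (demand k i)[j] = fun _ => decide (j = i) := by
  simp [demand]

theorem getElem_avoid {b : List (Fin 3)} {j : ℕ} (h : j < (avoid b).length) :
    (avoid b)[j] = fun τ' => decide (τ' ≠ b[j]'(by simpa [avoid] using h)) := by
  simp [avoid]

theorem exists_mem_clause_iff {k n : ℕ} {G : SimpleGraph (Fin n)} {tpl : List (Fin 3 → Bool)}
    (htpl : tpl.length = k) (v : Fin n) (x : Fin ((n + 1) * k) → Bool) :
    (∃ a : Fin ((n + 1) * k), (a : ℕ) ∈ clauseArgs tpl 0 (List.ofFn (kind G v)) ∧ x a = true) ↔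
      ∃ (p : Fin (n + 1)) (i : Fin k), x (finProdFinEquiv (p, i)) = true ∧
        tpl[(i : ℕ)] (kind G v p) = true := by
  subst htpl
  constructor
  · rintro ⟨a, ha, hx⟩
    obtain ⟨p, i, τ, m, hp, hi, hm, e⟩ := mem_clauseArgs.1 ha
    obtain ⟨hp', rfl⟩ := List.getElem?_eq_some_iff.1 hp
    obtain ⟨hi', rfl⟩ := List.getElem?_eq_some_iff.1 hi
    refine ⟨⟨p, by simpa using hp'⟩, ⟨i, hi'⟩, ?_, by rwa [List.getElem_ofFn] at hm⟩
    convert hx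
    ext
    simp [e]
  · rintro ⟨p, i, hx, hm⟩
    refine ⟨_, mem_clauseArgs.2 ⟨p, i, kind G v p, tpl[(i : ℕ)],
      by rw [List.getElem?_eq_getElem (by simp; omega), List.getElem_ofFn], by simp, hm, ?_⟩, hx⟩
    simp

/-- The weight k together with at least one true variable per index `i` forces exactly one, so a
satisfying input is the graph of a function `c`; the remaining clauses exclude every forbidden word.
-/
theorem exists_choice_iff {s r : List Bool} {k n : ℕ} (G : SimpleGraph (Fin n)) :
    (∃ x : Fin ((n + 1) * k) → Bool, (Finset.univ.filter fun i => x i = true).card = k ∧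
      ∀ cl ∈ clauses (templatesOf s r k) (rows G), ∃ a : Fin ((n + 1) * k),
        (a : ℕ) ∈ cl ∧ x a = true) ↔
    ∃ c : Fin k → Fin (n + 1), ∀ v, allowed s r (List.ofFn fun i => kind G v (c i)) = true := by
  -- The clauses in terms of pairs: every choice is made, and every forbidden word is contradicted
  -- by some true variable. The demands are repeated for each vertex, which does no harm.
  have hcls : ∀ x : Fin ((n + 1) * k) → Bool,
      (∀ cl ∈ clauses (templatesOf s r k) (rows G), ∃ a : Fin ((n + 1) * k),
        (a : ℕ) ∈ cl ∧ x a = true) ↔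
      ∀ v : Fin n, (∀ i : Fin k, ∃ p, x (finProdFinEquiv (p, i)) = true) ∧
        ∀ b : Fin k → Fin 3, allowed s r (List.ofFn b) = false →
          ∃ (p : Fin (n + 1)) (i : Fin k), x (finProdFinEquiv (p, i)) = true ∧
            kind G v p ≠ b i := by
    intro x
    constructor
    · intro h v
      have hv : ∀ tpl ∈ templatesOf s r k,
          clauseArgs tpl 0 (List.ofFn (kind G v)) ∈ clauses (templatesOf s r k) (rows G) :=
        fun tpl htpl => List.mem_flatMap.2 ⟨tpl, htpl, List.mem_map.2
          ⟨_, List.mem_map.2 ⟨v, List.mem_finRange v, rfl⟩, rfl⟩⟩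
      constructor
      · intro i
        have hd : demand k i ∈ templatesOf s r k := List.mem_append_left _
          (List.mem_map.2 ⟨i, List.mem_range.2 i.2, rfl⟩)
        obtain ⟨p, j, hx, hj⟩ := (exists_mem_clause_iff (length_of_mem_templatesOf hd) v x).1
          (h _ (hv _ hd))
        have : j = i := by
          rw [getElem_demand] at hj
          simpa [Fin.ext_iff] using hj
        exact ⟨p, this ▸ hx⟩
      · intro b hb
        have hd : avoid (List.ofFn b) ∈ templatesOf s r k := List.mem_append_right _
          (List.mem_filterMap.2 ⟨List.ofFn b, mem_patterns.2 List.length_ofFn, by simp [hb]⟩)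
        obtain ⟨p, j, hx, hj⟩ := (exists_mem_clause_iff (length_of_mem_templatesOf hd) v x).1
          (h _ (hv _ hd))
        rw [getElem_avoid] at hj
        exact ⟨p, j, hx, by simpa using hj⟩
    · intro h cl hcl
      simp only [clauses, rows, List.mem_flatMap, List.mem_map] at hcl
      obtain ⟨tpl, htpl, row, ⟨v, -, rfl⟩, rfl⟩ := hcl
      refine (exists_mem_clause_iff (length_of_mem_templatesOf htpl) v x).2 ?_
      have htpl' := htpl
      simp only [templatesOf, List.mem_append, List.mem_map, List.mem_filterMap] at htpl'
      rcases htpl' with ⟨i, hi, rfl⟩ | ⟨b, hb, hb'⟩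
      · obtain ⟨p, hp⟩ := (h v).1 ⟨i, List.mem_range.1 hi⟩
        exact ⟨p, _, hp, by rw [getElem_demand]; simp⟩
      · split_ifs at hb' with hall
        obtain rfl := Option.some.inj hb'
        have hbk := mem_patterns.1 hb
        subst hbk
        obtain ⟨p, i, hx, hne⟩ := (h v).2 (fun i => b[i]) (by simpa using hall)
        exact ⟨p, i, hx, by rw [getElem_avoid]; simpa using hne⟩
  simp only [hcls]
  have hcard : ∀ x : Fin ((n + 1) * k) → Bool, (Finset.univ.filter fun i => x i = true).card =
      (Finset.univ.filter fun q => x (finProdFinEquiv q) = true).card := by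
    intro x
    refine (Finset.card_bij (fun q _ => finProdFinEquiv q) ?_ ?_ ?_).symm
    · simp
    · intro a _ b _ h; exact finProdFinEquiv.injective h
    · intro a ha
      refine ⟨finProdFinEquiv.symm a, ?_, Equiv.apply_symm_apply _ a⟩
      rw [Finset.mem_filter, Equiv.apply_symm_apply]
      exact ⟨Finset.mem_univ _, (Finset.mem_filter.1 ha).2⟩
  constructor
  · rintro ⟨x, hx, h⟩
    -- Without vertices there are no rows and hence no demands, but then any `c` will do.
    rcases Nat.eq_zero_or_pos n with rfl | hn
    · exact ⟨fun _ => 0, fun v => v.elim0⟩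
    choose c hc using (h ⟨0, hn⟩).1
    refine ⟨c, fun v => ?_⟩
    -- The k pairs `(c i, i)` are true, and only k variables are.
    have huniq : ∀ p i, x (finProdFinEquiv (p, i)) = true → p = c i := by
      have hsub : (Finset.univ.image fun i => (c i, i)) ⊆
          Finset.univ.filter fun q => x (finProdFinEquiv q) = true := by
        intro q hq
        obtain ⟨i, -, rfl⟩ := Finset.mem_image.1 hq
        simpa using hc i
      have heq := Finset.eq_of_subset_of_card_le hsub (by
        rw [← hcard, hx, Finset.card_image_of_injective _ fun i j h => (Prod.ext_iff.1 h).2]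
        simp)
      intro p i hp
      have : (p, i) ∈ Finset.univ.image fun i => (c i, i) := by
        rw [heq]; simpa using hp
      obtain ⟨j, -, hj⟩ := Finset.mem_image.1 this
      obtain ⟨h₁, rfl⟩ := Prod.ext_iff.1 hj
      exact h₁.symm
    by_contra hall
    obtain ⟨p, i, hp, hne⟩ := (h v).2 (fun i => kind G v (c i)) (by simpa using hall)
    exact hne (by rw [huniq p i hp])
  · rintro ⟨c, hc⟩
    refine ⟨fun a => decide ((finProdFinEquiv.symm a).1 = c (finProdFinEquiv.symm a).2), ?_,
      fun v => ⟨fun i => ⟨c i, by simp⟩, fun b hb => ?_⟩⟩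
    · rw [hcard]
      have : (Finset.univ.filter fun q : Fin (n + 1) × Fin k =>
          decide ((finProdFinEquiv.symm (finProdFinEquiv q)).1 =
            c (finProdFinEquiv.symm (finProdFinEquiv q)).2) = true) =
          Finset.univ.image fun i => (c i, i) := by
        ext ⟨p, i⟩
        simp [Prod.ext_iff, eq_comm]
      rw [this, Finset.card_image_of_injective _ fun i j h => (Prod.ext_iff.1 h).2]
      simp
    · by_contra hcon
      push Not at hcon
      -- If no true variable contradicts `b`, then `b` is the word that `v` sees, and that word is
      -- allowed.
      have : b = fun i => kind G v (c i) := funext fun i => (hcon (c i) i (by simp)).symm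
      rw [this, hc v] at hb
      simp at hb

/-! ### Sequences of choices as dominating sets. -/

theorem count_ofFn {α : Type} [DecidableEq α] {k : ℕ} (f : Fin k → α) (a : α) :
    (List.ofFn f).count a = (Finset.univ.filter fun i => f i = a).card := by
  have h := Fin.card_filter_univ_eq_vector_get_eq_count a (List.Vector.ofFn f)
  rw [List.Vector.toList_ofFn] at h
  rw [← h]
  congr 1
  ext i
  simp [eq_comm]

theorem getD_table {χ : ℕ → Bool} {k j : ℕ} (h : j ≤ k) : (table χ k).getD j false = χ j := by
  rw [table, List.getD_eq_getElem _ _ (by simpa using Nat.lt_succ_of_le h)]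
  simp

section

variable {k n : ℕ} {G : SimpleGraph (Fin n)}

theorem kind_eq_zero {v : Fin n} {p : Fin (n + 1)} : kind G v p = 0 ↔ p = v.castSucc := by
  unfold kind
  split_ifs with h₁ h₂ <;> simp [h₁]

theorem kind_eq_one {v : Fin n} {p : Fin (n + 1)} :
    kind G v p = 1 ↔ ∃ u, p = u.castSucc ∧ G.Adj v u := by
  unfold kind
  split_ifs with h₁ h₂
  · simp only [Fin.isValue, zero_ne_one, false_iff, not_exists, not_and]
    rintro u hu hadj
    rw [h₁] at hu
    exact hadj.ne (Fin.castSucc_injective n hu)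
  · simpa using h₂
  · simpa using h₂

variable {c : Fin k → Fin (n + 1)} {D : Finset (Fin n)}

theorem count_zero_eq (hc : ∀ i j, c i = c j → c i ≠ Fin.last n → i = j)
    (hD : ∀ u, u ∈ D ↔ ∃ i, c i = u.castSucc) (v : Fin n) :
    (List.ofFn fun i => kind G v (c i)).count 0 = if v ∈ D then 1 else 0 := by
  simp only [count_ofFn, kind_eq_zero]
  split_ifs with hv
  · obtain ⟨i, hi⟩ := (hD v).1 hv
    rw [Finset.card_eq_one]
    refine ⟨i, ?_⟩
    ext j
    simp only [Finset.mem_filter, Finset.mem_univ, true_and, Finset.mem_singleton]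
    constructor
    · intro hj
      exact hc j i (hj.trans hi.symm) (hj ▸ (Fin.castSucc_lt_last v).ne)
    · rintro rfl
      exact hi
  · rw [Finset.card_eq_zero, Finset.filter_eq_empty_iff]
    exact fun i _ hi => hv ((hD v).2 ⟨i, hi⟩)

/-- Each chosen neighbour is chosen by exactly one index, so counting indices is counting neighbours
in `D`. -/
theorem count_one_eq (hc : ∀ i j, c i = c j → c i ≠ Fin.last n → i = j)
    (hD : ∀ u, u ∈ D ↔ ∃ i, c i = u.castSucc) (v : Fin n) :
    (List.ofFn fun i => kind G v (c i)).count 1 = (G.neighborSet v ∩ D).ncard := by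
  classical
  simp only [count_ofFn, kind_eq_one]
  have : (G.neighborSet v ∩ D) =
      ((D.filter fun u => G.Adj v u : Finset (Fin n)) : Set (Fin n)) := by
    ext u; simp [and_comm]
  rw [this, Set.ncard_coe_finset]
  have hex : ∀ u ∈ D.filter fun u => G.Adj v u, ∃ i, c i = u.castSucc := fun u hu =>
    (hD u).1 (Finset.mem_filter.1 hu).1
  choose f hf using hex
  refine (Finset.card_bij f ?_ ?_ ?_).symm
  · intro u hu
    simp only [Finset.mem_filter, Finset.mem_univ, true_and]
    exact ⟨u, hf u hu, (Finset.mem_filter.1 hu).2⟩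
  · intro u hu w hw h
    have h₁ := hf u hu
    rw [h, hf w hw] at h₁
    exact (Fin.castSucc_injective n h₁).symm
  · intro i hi
    simp only [Finset.mem_filter, Finset.mem_univ, true_and] at hi
    obtain ⟨u, hu, hadj⟩ := hi
    have huD : u ∈ D.filter fun u => G.Adj v u := Finset.mem_filter.2 ⟨(hD u).2 ⟨i, hu⟩, hadj⟩
    refine ⟨u, huD, hc _ _ ((hf u huD).trans hu.symm) ?_⟩
    rw [hf u huD]
    exact (Fin.castSucc_lt_last u).ne

theorem allowed_table_iff {σ ρ : Set ℕ} {χσ χρ : ℕ → Bool} (hσ : ∀ j, χσ j = true ↔ j ∈ σ)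
    (hρ : ∀ j, χρ j = true ↔ j ∈ ρ) (hc : ∀ i j, c i = c j → c i ≠ Fin.last n → i = j)
    (hD : ∀ u, u ∈ D ↔ ∃ i, c i = u.castSucc) (v : Fin n) :
    allowed (table χσ k) (table χρ k) (List.ofFn fun i => kind G v (c i)) = true ↔
      if v ∈ D then (G.neighborSet v ∩ D).ncard ∈ σ else (G.neighborSet v ∩ D).ncard ∈ ρ := by
  -- The count never leaves the range of the tables, so the default `false` is not reached.
  have hle : (List.ofFn fun i => kind G v (c i)).count 1 ≤ k :=
    List.count_le_length.trans (by simp)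
  rw [allowed, getD_table hle, getD_table hle, count_one_eq hc hD v, count_zero_eq hc hD v]
  by_cases hv : v ∈ D <;> simp [hv, hσ, hρ]

theorem exists_dominating_iff {σ ρ : Set ℕ} {χσ χρ : ℕ → Bool} (hσ : ∀ j, χσ j = true ↔ j ∈ σ)
    (hρ : ∀ j, χρ j = true ↔ j ∈ ρ) (k : ℕ) (G : SimpleGraph (Fin n)) :
    (∃ c : Fin k → Fin (n + 1), ∀ v,
      allowed (table χσ k) (table χρ k) (List.ofFn fun i => kind G v (c i)) = true) ↔
    ∃ D : Finset (Fin n), IsSigmaRhoDominating σ ρ G D ∧ D.card ≤ k := by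
  have dom_iff : ∀ D : Finset (Fin n), IsSigmaRhoDominating σ ρ G D ↔ ∀ v,
      if v ∈ D then (G.neighborSet v ∩ D).ncard ∈ σ else (G.neighborSet v ∩ D).ncard ∈ ρ := by
    intro D
    constructor
    · intro h v
      split_ifs with hv
      exacts [h.1 v hv, h.2 v hv]
    · exact fun h => ⟨fun v hv => by simpa [hv] using h v, fun v hv => by simpa [hv] using h v⟩
  constructor
  · rintro ⟨c, h⟩
    -- A vertex chosen twice would see two letters 0 in its own word, which `allowed` rejects.
    have hc : ∀ i j, c i = c j → c i ≠ Fin.last n → i = j := by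
      intro i j hij hi
      obtain ⟨v, hv⟩ := Fin.exists_castSucc_eq.2 hi
      have hv' := h v
      have hle : (List.ofFn fun i => kind G v (c i)).count 0 ≤ 1 := by
        by_contra hgt
        simp [allowed, show ¬ (List.ofFn fun i => kind G v (c i)).count 0 = 0 by omega,
          show ¬ (List.ofFn fun i => kind G v (c i)).count 0 = 1 by omega] at hv'
      rw [count_ofFn, Finset.card_le_one] at hle
      exact hle i (by simp [kind_eq_zero, hv]) j (by simp [kind_eq_zero, hv, hij])
    let D : Finset (Fin n) := Finset.univ.filter fun u => ∃ i, c i = u.castSucc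
    have hD : ∀ u, u ∈ D ↔ ∃ i, c i = u.castSucc := by simp [D]
    refine ⟨D, (dom_iff D).2 fun v => (allowed_table_iff hσ hρ hc hD v).1 (h v), ?_⟩
    calc D.card = (D.map Fin.castSuccEmb).card := (Finset.card_map _).symm
      _ ≤ (Finset.univ.image c).card := Finset.card_le_card fun p hp => by
          obtain ⟨u, hu, rfl⟩ := Finset.mem_map.1 hp
          obtain ⟨i, hi⟩ := (hD u).1 hu
          exact Finset.mem_image.2 ⟨i, Finset.mem_univ _, hi⟩
      _ ≤ k := Finset.card_image_le.trans (by simp)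
  · rintro ⟨D, hdom, hk⟩
    let e := D.equivFin
    -- The first `D.card` choices enumerate `D`; the others are blank. This is how "at most k"
    -- becomes "exactly k" true variables.
    let c : Fin k → Fin (n + 1) := fun i =>
      if h : (i : ℕ) < D.card then (e.symm ⟨i, h⟩ : Fin n).castSucc else Fin.last n
    have hc : ∀ i j, c i = c j → c i ≠ Fin.last n → i = j := by
      intro i j hij hi
      by_cases h₁ : (i : ℕ) < D.card
      · by_cases h₂ : (j : ℕ) < D.card
        · simp only [c, h₁, h₂, dif_pos] at hij
          have := e.symm.injective (Subtype.ext (Fin.castSucc_injective n hij))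
          exact Fin.ext (by simpa using this)
        · simp only [c, h₂, dif_neg, not_false_iff] at hij
          exact absurd hij hi
      · simp [c, h₁] at hi
    have hD : ∀ u, u ∈ D ↔ ∃ i, c i = u.castSucc := by
      intro u
      constructor
      · intro hu
        refine ⟨⟨e ⟨u, hu⟩, (e ⟨u, hu⟩).2.trans_le hk⟩, ?_⟩
        simp [c]
      · rintro ⟨i, hi⟩
        by_cases h₁ : (i : ℕ) < D.card
        · simp only [c, h₁, dif_pos] at hi
          rw [← Fin.castSucc_injective n hi]
          exact (e.symm ⟨i, h₁⟩).2
        · simp only [c, h₁, dif_neg, not_false_iff] at hi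
          exact absurd hi.symm (Fin.castSucc_lt_last u).ne
    exact ⟨c, fun v => (allowed_table_iff hσ hρ hc hD v).2 ((dom_iff D).1 hdom v)⟩

end

/-- The circuit of an instance. -/
noncomputable def circuit (χσ χρ : ℕ → Bool) (x : GraphInst) : Circuit :=
  cnfCircuit ((x.n + 1) * x.k) (clauses (templates χσ χρ x.k) (rows x.G)) lt_of_mem_clauses

/-- The reduction to the weighted satisfiability of circuits of weft and depth two. -/
noncomputable def reduction (χσ χρ : ℕ → Bool) (x : GraphInst) : (weightedCircuitSat 2 2).Inst :=
  (⟨circuit χσ χρ x, cnfCircuit_weft_le _, cnfCircuit_depth_le _⟩, x.k)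

theorem yes_iff {σ ρ : Set ℕ} {χσ χρ : ℕ → Bool} (hσ : ∀ j, χσ j = true ↔ j ∈ σ)
    (hρ : ∀ j, χρ j = true ↔ j ∈ ρ) (x : GraphInst) :
    (sigmaRhoDominatingSet σ ρ).Yes x ↔ (weightedCircuitSat 2 2).Yes (reduction χσ χρ x) := by
  refine (exists_dominating_iff hσ hρ x.k x.G).symm.trans ?_
  rw [← exists_choice_iff]
  exact exists_congr fun y => and_congr_right fun _ =>
    (cnfCircuit_eval lt_of_mem_clauses y).symm

end SigmaRho

namespace Prog

open ParamComplexity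

/-! ### Timed building blocks -/

section

variable {K : Type}

/-- Do nothing of effect. -/
def skip (a : K) : Prog K := .push a true ;; .pop a

/-- Move one bit from stack `a` to stack `b`. -/
def moveBit (a b : K) : Prog K := .ite a isOne (.pop a ;; .push b true) (.pop a ;; .push b false)

/-- Move all of stack `a` to stack `b`, reversing it. -/
def pour (a b : K) : Prog K := .loop a Option.isSome (moveBit a b)

/-- Empty the stack `a`. -/
def clear (a : K) : Prog K := .loop a Option.isSome (.pop a)

/-- Push the bits of a word. -/
def pushAll (a : K) : List Bool → Prog K
  | [] => skip a
  | b :: w => .push a b ;; pushAll a w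

/-- Push as many `1`s to stack `b` as there are on stack `a`, using the empty stack `d`. -/
def addNum (a d b : K) : Prog K :=
  .loop a Option.isSome (.pop a ;; .push d true ;; .push b true) ;; pour d a

/-- Push the reversed code of the size of stack `a` to stack `b`, using the empty stack `d`. -/
def emitNum (a d b : K) : Prog K := addNum a d b ;; .push b false

variable [DecidableEq K]

/-- Timed loop rule: each round costs its test and at most `T`, and the failing test costs one more
step. Only splittings of `total` are considered, so `T` may rest on bounds that hold at actual
positions. -/
theorem runsIn_loop_list {α : Type} {a : K} {c : Option Bool → Bool} {p : Prog K} {T : ℕ}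
    (total : List α) (I : List α → List α → K → List Bool)
    (h : ∀ d x l, d.reverse ++ x :: l = total →
      c (I d (x :: l) a).head? = true ∧ RunsIn p (I d (x :: l)) T (I (x :: d) l))
    (h₀ : c (I total.reverse [] a).head? = false) :
    RunsIn (.loop a c p) (I [] total) (total.length * (T + 1) + 1) (I total.reverse []) := by
  suffices ∀ l d, d.reverse ++ l = total →
      RunsIn (.loop a c p) (I d l) (l.length * (T + 1) + 1) (I total.reverse []) from
    this total [] rfl
  intro l
  induction l with
  | nil =>
    intro d hd
    obtain rfl : d = total.reverse := by rw [← hd]; simp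
    simpa using RunsIn.loop_false h₀
  | cons x l ih =>
    intro d hd
    refine (RunsIn.loop_true (h d x l hd).1 (h d x l hd).2
      (ih (x :: d) (by simpa using hd))).mono ?_
    rw [List.length_cons]
    linarith

theorem runsIn_loop_nat {a : K} {c : Option Bool → Bool} {p : Prog K} {T : ℕ} (n : ℕ)
    (I : ℕ → ℕ → K → List Bool)
    (h : ∀ d r, d + (r + 1) = n →
      c (I d (r + 1) a).head? = true ∧ RunsIn p (I d (r + 1)) T (I (d + 1) r))
    (h₀ : c (I n 0 a).head? = false) :
    RunsIn (.loop a c p) (I 0 n) (n * (T + 1) + 1) (I n 0) := by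
  suffices ∀ r d, d + r = n → RunsIn (.loop a c p) (I d r) (r * (T + 1) + 1) (I n 0) from
    this n 0 (by simp)
  intro r
  induction r with
  | zero =>
    rintro d rfl
    simpa using RunsIn.loop_false h₀
  | succ r ih =>
    intro d hd
    refine (RunsIn.loop_true (h d r hd).1 (h d r hd).2 (ih (d + 1) (by omega))).mono ?_
    linarith

theorem runsIn_skip (a : K) (S : K → List Bool) : RunsIn (skip a) S 2 S :=
  ((runsIn_push _ _ _).seq (runsIn_pop _ _)).congr le_rfl (by simp)

theorem runsIn_moveBit {a b : K} (hab : a ≠ b) {S : K → List Bool} {x : Bool} {l : List Bool}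
    (h : S a = x :: l) :
    RunsIn (moveBit a b) S 3 (Function.update (Function.update S a l) b (x :: S b)) := by
  cases x
  · exact .ite_false (by simp [h, isOne]) (((runsIn_pop _ _).seq (runsIn_push _ _ _)).congr le_rfl
      (by simp [h, hab.symm]))
  · exact .ite_true (by simp [h, isOne]) (((runsIn_pop _ _).seq (runsIn_push _ _ _)).congr le_rfl
      (by simp [h, hab.symm]))

theorem runsIn_pour {a b : K} (hab : a ≠ b) (S : K → List Bool) :
    RunsIn (pour a b) S (4 * (S a).length + 1)
      (Function.update (Function.update S a []) b ((S a).reverse ++ S b)) := by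
  have h := runsIn_loop_list (a := a) (c := Option.isSome) (p := moveBit a b) (T := 3) (S a)
    (fun d l => Function.update (Function.update S a l) b (d ++ S b))
    (fun d x l _ => ⟨by simp [hab],
      (runsIn_moveBit (x := x) (l := l) hab (by simp [hab])).congr le_rfl (by
      funext j
      by_cases hb : j = b <;> by_cases ha : j = a <;> simp_all)⟩) (by simp [hab])
  simp only [Function.update_eq_self, List.nil_append] at h
  exact h.mono (by omega)

theorem runsIn_clear (a : K) (S : K → List Bool) :
    RunsIn (clear a) S (2 * (S a).length + 1) (Function.update S a []) := by
  have h := runsIn_loop_list (a := a) (c := Option.isSome) (p := .pop a) (T := 1) (S a)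
    (fun _ l => Function.update S a l)
    (fun d x l _ => ⟨by simp, (runsIn_pop _ _).congr le_rfl (by simp)⟩) (by simp)
  simp only [Function.update_eq_self] at h
  exact h.mono (by omega)

theorem runsIn_pushAll (a : K) (w : List Bool) (S : K → List Bool) :
    RunsIn (pushAll a w) S (w.length + 2) (Function.update S a (w.reverse ++ S a)) := by
  induction w generalizing S with
  | nil => exact (runsIn_skip a S).congr (by simp) (by simp)
  | cons b w ih =>
    exact ((runsIn_push _ _ _).seq (ih _)).congr (by simp; omega) (by simp)

/-- The source is drained into `d` and poured back. As it consists of ones only, reversal does not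
matter, and it can be read again later. -/
theorem runsIn_addNum {a d b : K} (had : a ≠ d) (hab : a ≠ b) (hdb : d ≠ b) {n : ℕ}
    {S : K → List Bool} (ha : S a = List.replicate n true) (hd : S d = []) :
    RunsIn (addNum a d b) S (8 * n + 2) (Function.update S b (List.replicate n true ++ S b)) := by
  have h := runsIn_loop_nat (a := a) (c := Option.isSome)
    (p := .pop a ;; .push d true ;; .push b true) (T := 3) n
    (fun i r => Function.update (Function.update (Function.update S a (List.replicate r true)) d
      (List.replicate i true)) b (List.replicate i true ++ S b))
    (fun i r _ => ⟨by simp [had, hab, List.replicate_succ],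
      ((runsIn_pop _ _).seq ((runsIn_push _ _ _).seq (runsIn_push _ _ _))).congr le_rfl (by
      funext j
      by_cases hb : j = b <;> by_cases hd : j = d <;> by_cases ha : j = a <;>
        simp_all [List.replicate_succ])⟩) (by simp [had, hab])
  have e : (Function.update (Function.update (Function.update S a (List.replicate n true)) d
      (List.replicate 0 true)) b (List.replicate 0 true ++ S b)) = S := by
    rw [← ha, Function.update_eq_self, List.replicate_zero, List.nil_append, ← hd,
      Function.update_eq_self, Function.update_eq_self]
  rw [e] at h
  refine (h.seq (runsIn_pour had.symm _)).congr ?_ ?_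
  · simp [hdb]; omega
  · funext j
    by_cases hb : j = b <;> by_cases hd : j = d <;> by_cases ha : j = a <;> simp_all

/-- Output is accumulated in reverse: pushing the ones and then the delimiter writes a number. -/
theorem reverse_encodeNat (n : ℕ) : (encodeNat n).reverse = false :: List.replicate n true := by
  have := replicate_append_encodeNat n []
  rw [List.append_nil] at this
  rw [← this]
  simp

theorem runsIn_emitNum {a d b : K} (had : a ≠ d) (hab : a ≠ b) (hdb : d ≠ b) {n : ℕ}
    {S : K → List Bool} (ha : S a = List.replicate n true) (hd : S d = []) :
    RunsIn (emitNum a d b) S (8 * n + 3) (Function.update S b ((encodeNat n).reverse ++ S b)) :=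
  ((runsIn_addNum had hab hdb ha hd).seq (runsIn_push _ _ _)).congr le_rfl
    (by simp [reverse_encodeNat])

end

end Prog

namespace SigmaRho

open ParamComplexity Prog

/-! ### The registers of the machine -/

/-- The stacks of the machine besides those that serve to compute the templates: `inp` and `out`
hold the input and the output, and `acc` the reversed output while it is produced; `nn`, `kk`, `ee`,
`gg`, `cc` hold the numbers of vertices, of choices, of variables, of clauses, and the current
variable in unary; `la`, `ra`, `lb`, `rb` tell the position of the diagonal in the current row of
the adjacency matrix; the rows of kinds are kept on `mr` and `mm`, the current template on `br` and
`bb`; `dd` is for temporary use. -/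
inductive Reg
  | inp | out | acc | nn | kk | la | ra | lb | rb | mm | mr | bb | br | cc | dd | ee | gg
  deriving DecidableEq

instance : Fintype Reg where
  elems := {.inp, .out, .acc, .nn, .kk, .la, .ra, .lb, .rb, .mm, .mr, .bb, .br, .cc, .dd, .ee, .gg}
  complete r := by cases r <;> decide

/-- All stacks of the machine. -/
abbrev Stk := Fin 4 ⊕ Reg

/-- The stack for the input of the computation of the templates. -/
abbrev main : Stk := .inl 0

/-- The stack of the templates. -/
abbrev pp : Stk := .inl 1

/-- The contents of the stacks. -/
structure Mem where
  (main pp inp out acc nn kk la ra lb rb mm mr bb br cc dd ee gg : List Bool)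

namespace Mem

/-- The contents of the registers. -/
def reg (m : Mem) : Reg → List Bool
  | .inp => m.inp
  | .out => m.out
  | .acc => m.acc
  | .nn => m.nn
  | .kk => m.kk
  | .la => m.la
  | .ra => m.ra
  | .lb => m.lb
  | .rb => m.rb
  | .mm => m.mm
  | .mr => m.mr
  | .bb => m.bb
  | .br => m.br
  | .cc => m.cc
  | .dd => m.dd
  | .ee => m.ee
  | .gg => m.gg

/-- The contents of all stacks. -/
def get (m : Mem) : Stk → List Bool := Sum.elim (quad m.main m.pp [] []) m.reg

variable (m : Mem) (x : List Bool)

@[simp] theorem get_main : m.get SigmaRho.main = m.main := rfl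
@[simp] theorem get_pp : m.get SigmaRho.pp = m.pp := rfl
@[simp] theorem get_inp : m.get (.inr .inp) = m.inp := rfl
@[simp] theorem get_out : m.get (.inr .out) = m.out := rfl
@[simp] theorem get_acc : m.get (.inr .acc) = m.acc := rfl
@[simp] theorem get_nn : m.get (.inr .nn) = m.nn := rfl
@[simp] theorem get_kk : m.get (.inr .kk) = m.kk := rfl
@[simp] theorem get_la : m.get (.inr .la) = m.la := rfl
@[simp] theorem get_ra : m.get (.inr .ra) = m.ra := rfl
@[simp] theorem get_lb : m.get (.inr .lb) = m.lb := rfl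
@[simp] theorem get_rb : m.get (.inr .rb) = m.rb := rfl
@[simp] theorem get_mm : m.get (.inr .mm) = m.mm := rfl
@[simp] theorem get_mr : m.get (.inr .mr) = m.mr := rfl
@[simp] theorem get_bb : m.get (.inr .bb) = m.bb := rfl
@[simp] theorem get_br : m.get (.inr .br) = m.br := rfl
@[simp] theorem get_cc : m.get (.inr .cc) = m.cc := rfl
@[simp] theorem get_dd : m.get (.inr .dd) = m.dd := rfl
@[simp] theorem get_ee : m.get (.inr .ee) = m.ee := rfl
@[simp] theorem get_gg : m.get (.inr .gg) = m.gg := rfl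

/-- Updates of the stack function become updates of record fields, so that `simp` normalises the
states of long runs. -/
theorem update_get_inr (r : Reg) (m' : Mem) (h₁ : m'.main = m.main) (h₂ : m'.pp = m.pp)
    (h : m'.reg = Function.update m.reg r x) : Function.update m.get (.inr r) x = m'.get := by
  rw [get, get, h₁, h₂, h, Sum.update_elim_inr]

@[simp] theorem update_main :
    Function.update m.get SigmaRho.main x = { m with main := x }.get := by
  simp only [get, Sum.update_elim_inl, update_quad_zero]; rfl

@[simp] theorem update_pp : Function.update m.get SigmaRho.pp x = { m with pp := x }.get := by
  simp only [get, Sum.update_elim_inl, update_quad_one]; rfl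

@[simp] theorem update_inp : Function.update m.get (.inr .inp) x = { m with inp := x }.get :=
  update_get_inr _ _ _ _ rfl rfl (funext fun r => by cases r <;> rfl)

@[simp] theorem update_out : Function.update m.get (.inr .out) x = { m with out := x }.get :=
  update_get_inr _ _ _ _ rfl rfl (funext fun r => by cases r <;> rfl)

@[simp] theorem update_acc : Function.update m.get (.inr .acc) x = { m with acc := x }.get :=
  update_get_inr _ _ _ _ rfl rfl (funext fun r => by cases r <;> rfl)

@[simp] theorem update_nn : Function.update m.get (.inr .nn) x = { m with nn := x }.get :=
  update_get_inr _ _ _ _ rfl rfl (funext fun r => by cases r <;> rfl)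

@[simp] theorem update_kk : Function.update m.get (.inr .kk) x = { m with kk := x }.get :=
  update_get_inr _ _ _ _ rfl rfl (funext fun r => by cases r <;> rfl)

@[simp] theorem update_la : Function.update m.get (.inr .la) x = { m with la := x }.get :=
  update_get_inr _ _ _ _ rfl rfl (funext fun r => by cases r <;> rfl)

@[simp] theorem update_ra : Function.update m.get (.inr .ra) x = { m with ra := x }.get :=
  update_get_inr _ _ _ _ rfl rfl (funext fun r => by cases r <;> rfl)

@[simp] theorem update_lb : Function.update m.get (.inr .lb) x = { m with lb := x }.get :=
  update_get_inr _ _ _ _ rfl rfl (funext fun r => by cases r <;> rfl)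

@[simp] theorem update_rb : Function.update m.get (.inr .rb) x = { m with rb := x }.get :=
  update_get_inr _ _ _ _ rfl rfl (funext fun r => by cases r <;> rfl)

@[simp] theorem update_mm : Function.update m.get (.inr .mm) x = { m with mm := x }.get :=
  update_get_inr _ _ _ _ rfl rfl (funext fun r => by cases r <;> rfl)

@[simp] theorem update_mr : Function.update m.get (.inr .mr) x = { m with mr := x }.get :=
  update_get_inr _ _ _ _ rfl rfl (funext fun r => by cases r <;> rfl)

@[simp] theorem update_bb : Function.update m.get (.inr .bb) x = { m with bb := x }.get :=
  update_get_inr _ _ _ _ rfl rfl (funext fun r => by cases r <;> rfl)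

@[simp] theorem update_br : Function.update m.get (.inr .br) x = { m with br := x }.get :=
  update_get_inr _ _ _ _ rfl rfl (funext fun r => by cases r <;> rfl)

@[simp] theorem update_cc : Function.update m.get (.inr .cc) x = { m with cc := x }.get :=
  update_get_inr _ _ _ _ rfl rfl (funext fun r => by cases r <;> rfl)

@[simp] theorem update_dd : Function.update m.get (.inr .dd) x = { m with dd := x }.get :=
  update_get_inr _ _ _ _ rfl rfl (funext fun r => by cases r <;> rfl)

@[simp] theorem update_ee : Function.update m.get (.inr .ee) x = { m with ee := x }.get :=
  update_get_inr _ _ _ _ rfl rfl (funext fun r => by cases r <;> rfl)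

@[simp] theorem update_gg : Function.update m.get (.inr .gg) x = { m with gg := x }.get :=
  update_get_inr _ _ _ _ rfl rfl (funext fun r => by cases r <;> rfl)

end Mem

/-! ### Writing one clause -/

/-- The code of a list without its end. -/
def entries {α : Type} (e : α → List Bool) (l : List α) : List Bool :=
  l.flatMap fun a => true :: e a

theorem encodeList_eq_entries {α : Type} (e : α → List Bool) (l : List α) :
    encodeList e l = entries e l ++ [false] := encodeList_eq_flatMap e l

theorem entries_append {α : Type} (e : α → List Bool) (l l' : List α) :
    entries e (l ++ l') = entries e l ++ entries e l' := List.flatMap_append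

theorem entries_singleton {α : Type} (e : α → List Bool) (a : α) :
    entries e [a] = true :: e a := by simp [entries]

theorem length_encodeList_mask (l : List (Fin 3 → Bool)) :
    (encodeList encodeMask l).length = 4 * l.length + 1 := by
  induction l with
  | nil => rfl
  | cons x l ih => simp [encodeList, encodeMask, ih]; omega

/-- The definition recurses from the front, whereas the loop invariants grow at the end. -/
theorem slotArgs_append_singleton (τ : Fin 3) (c : ℕ) (l : List (Fin 3 → Bool))
    (x : Fin 3 → Bool) :
    slotArgs τ c (l ++ [x]) = slotArgs τ c l ++ if x τ then [c + l.length] else [] := by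
  induction l generalizing c with
  | nil => simp [slotArgs]
  | cons y l ih =>
    simp only [List.cons_append, slotArgs, ih, List.length_cons]
    rw [show c + 1 + l.length = c + (l.length + 1) by omega]
    split_ifs <;> simp

theorem clauseArgs_append_singleton (tpl : List (Fin 3 → Bool)) (c : ℕ) (l : List (Fin 3))
    (τ : Fin 3) :
    clauseArgs tpl c (l ++ [τ]) =
      clauseArgs tpl c l ++ slotArgs τ (c + l.length * tpl.length) tpl := by
  induction l generalizing c with
  | nil => simp [clauseArgs]
  | cons y l ih =>
    simp only [List.cons_append, clauseArgs, ih, List.length_cons, List.append_assoc]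
    rw [show c + tpl.length + l.length * tpl.length = c + (l.length + 1) * tpl.length by ring]

/-- Look at a bit of the current mask; if `b` holds and the bit is set, write the current variable
to the output. -/
def bitProg : Bool → Prog Stk
  | true => .ite (.inr .bb) isOne
      (.push (.inr .acc) true ;; emitNum (.inr .cc) (.inr .dd) (.inr .acc)) (skip (.inr .dd)) ;;
      moveBit (.inr .bb) (.inr .br)
  | false => moveBit (.inr .bb) (.inr .br)

/-- Write the variables of a column of kind `τ`. -/
def slotsProg (τ : Fin 3) : Prog Stk :=
  pour (.inr .br) (.inr .bb) ;;
  .loop (.inr .bb) isOne (moveBit (.inr .bb) (.inr .br) ;; bitProg (τ = 0) ;; bitProg (τ = 1) ;;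
    bitProg (τ = 2) ;; .push (.inr .cc) true) ;;
  moveBit (.inr .bb) (.inr .br)

theorem runsIn_bitProg (b x : Bool) (l : List Bool) (c : ℕ) (m : Mem) (hd : m.dd = [])
    (hc : m.cc = List.replicate c true) (hb : m.bb = x :: l) :
    RunsIn (bitProg b) m.get (8 * c + 8) { m with
      bb := l
      br := x :: m.br
      acc := (if b && x then (true :: encodeNat c).reverse else []) ++ m.acc }.get := by
  have hmove : ∀ m : Mem, m.bb = x :: l → RunsIn (moveBit (.inr .bb) (.inr .br)) m.get 3
      { m with bb := l, br := x :: m.br }.get := fun m hb =>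
    (runsIn_moveBit (by simp) (by simpa using hb)).congr le_rfl (by simp)
  cases b
  · exact (hmove _ hb).congr (by omega) (by simp)
  cases x
  · exact ((RunsIn.ite_false (by simp [hb, isOne]) (runsIn_skip _ _)).seq (hmove _ hb)).congr
      (by omega) (by simp)
  · have h₁ := (runsIn_push (.inr .acc) true m.get).seq (runsIn_emitNum (a := .inr .cc)
      (d := .inr .dd) (b := .inr .acc) (n := c) (by simp) (by simp) (by simp) (by simpa using hc)
      (by simpa using hd))
    simp only [Mem.update_acc, Mem.get_acc] at h₁
    exact ((h₁.ite_true (by simp [hb, isOne])).seq (hmove _ hb)).congr (by omega) (by simp)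

/-- The template is poured to `bb` and returns to `br` bit by bit, ready for the next column. The
common bound `N` on the variable numbers makes the cost of all rounds uniform. -/
theorem runsIn_slotsProg (τ : Fin 3) (tpl : List (Fin 3 → Bool)) (c N : ℕ) (m : Mem)
    (hd : m.dd = []) (hbb : m.bb = []) (hbr : m.br = (encodeList encodeMask tpl).reverse)
    (hc : m.cc = List.replicate c true) (hN : c + tpl.length ≤ N) :
    RunsIn (slotsProg τ) m.get (tpl.length * (24 * N + 45) + 9) { m with
      cc := List.replicate (c + tpl.length) true
      acc := (entries encodeNat (slotArgs τ c tpl)).reverse ++ m.acc }.get := by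
  let I : List (Fin 3 → Bool) → List (Fin 3 → Bool) → Mem := fun d l => { m with
    bb := encodeList encodeMask l
    br := (entries encodeMask d.reverse).reverse
    cc := List.replicate (c + d.length) true
    acc := (entries encodeNat (slotArgs τ c d.reverse)).reverse ++ m.acc }
  have hpour : RunsIn (pour (.inr .br) (.inr .bb)) m.get (16 * tpl.length + 5) (I [] tpl).get := by
    refine (runsIn_pour (by simp) m.get).congr ?_ (by simp [I, hbr, hbb, ← hc, entries, slotArgs])
    simp [hbr, length_encodeList_mask]; omega
  have hbody : ∀ d x l, d.reverse ++ x :: l = tpl →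
      RunsIn (moveBit (.inr .bb) (.inr .br) ;; bitProg (τ = 0) ;; bitProg (τ = 1) ;;
        bitProg (τ = 2) ;; .push (.inr .cc) true) (I d (x :: l)).get (24 * N + 28)
        (I (x :: d) l).get := by
    intro d x l hl
    have hlen : c + d.length ≤ N := by
      have := congrArg List.length hl
      simp at this
      omega
    have h₀ := runsIn_moveBit (a := (.inr .bb : Stk)) (b := .inr .br) (by simp)
      (S := (I d (x :: l)).get) (x := true) (l := encodeMask x ++ encodeList encodeMask l) rfl
    simp only [Mem.update_bb, Mem.update_br, Mem.get_br] at h₀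
    refine RunsIn.congr (h₀.seq ((runsIn_bitProg _ (x 0)
      (x 1 :: x 2 :: encodeList encodeMask l) (c + d.length) _ (by exact hd) (by rfl) (by rfl)).seq
      ((runsIn_bitProg _ (x 1) (x 2 :: encodeList encodeMask l) (c + d.length) _ (by exact hd)
        (by rfl) (by rfl)).seq
        ((runsIn_bitProg _ (x 2) (encodeList encodeMask l) (c + d.length) _ (by exact hd) (by rfl)
          (by rfl)).seq
          (runsIn_push _ _ _))))) ?_ ?_
    · omega
    have hacc : entries encodeNat (slotArgs τ c (d.reverse ++ [x])) =
        entries encodeNat (slotArgs τ c d.reverse) ++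
          if x τ then true :: encodeNat (c + d.length) else [] := by
      rw [slotArgs_append_singleton, entries_append, List.length_reverse]
      split_ifs <;> simp [entries]
    simp only [Mem.update_cc, Mem.get_cc, I, entries_append, entries_singleton, encodeMask,
      List.reverse_cons, List.length_cons, hacc]
    congr 1
    -- Of the three mask bits only the one belonging to `τ` can cause output.
    fin_cases τ <;> simp [List.replicate_succ, ← Nat.add_assoc] <;> split_ifs <;> simp
  have hloop := runsIn_loop_list (a := (.inr .bb : Stk)) (c := isOne) tpl (fun d l => (I d l).get)
    (fun d x l hl => ⟨by simp [I, encodeList, isOne], hbody d x l hl⟩)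
    (by simp [I, encodeList, isOne])
  have hend := runsIn_moveBit (a := (.inr .bb : Stk)) (b := .inr .br) (by simp)
      (S := (I tpl.reverse []).get) (x := false) (l := []) rfl
  refine (hpour.seq (hloop.seq hend)).congr (by linarith) ?_
  simp [I, hbr, hbb, encodeList_eq_entries]

/-- The binary code of a kind. -/
def encodeKind : Fin 3 → List Bool
  | 0 => [true]
  | 1 => [false, true]
  | 2 => [false, false]

/-- Read a kind and write the variables of a column of this kind. -/
def kindProg : Prog Stk :=
  moveBit (.inr .mm) (.inr .mr) ;;
  .ite (.inr .mm) isOne (moveBit (.inr .mm) (.inr .mr) ;; slotsProg 0)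
    (moveBit (.inr .mm) (.inr .mr) ;;
      .ite (.inr .mm) isOne (moveBit (.inr .mm) (.inr .mr) ;; slotsProg 1)
        (moveBit (.inr .mm) (.inr .mr) ;; slotsProg 2))

/-- Read a row of kinds and write its clause. -/
def rowProg : Prog Stk :=
  pushAll (.inr .acc) [true, true, true] ;;
  .loop (.inr .mm) isOne kindProg ;;
  moveBit (.inr .mm) (.inr .mr) ;;
  .push (.inr .acc) false ;; .push (.inr .gg) true ;; clear (.inr .cc)

/-- Read a template and write the clauses of all rows. -/
def templateProg : Prog Stk :=
  .loop pp isOne (moveBit pp (.inr .br) ;; moveBit pp (.inr .br) ;; moveBit pp (.inr .br) ;;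
    moveBit pp (.inr .br)) ;;
  moveBit pp (.inr .br) ;;
  pour (.inr .mr) (.inr .mm) ;;
  .loop (.inr .mm) Option.isSome rowProg ;;
  clear (.inr .br)

/-- Write the clauses of all templates. -/
def clausesProg : Prog Stk := .loop pp Option.isSome templateProg

/-- The code of a clause as an element of the list of gates. -/
def encodeClause (cl : List ℕ) : List Bool := true :: (Gate.or cl).encode

theorem runsIn_kindProg (τ : Fin 3) (tpl : List (Fin 3 → Bool)) (c N : ℕ) (rest : List Bool)
    (m : Mem) (hm : m.mm = true :: (encodeKind τ ++ rest))
    (hd : m.dd = []) (hbb : m.bb = []) (hbr : m.br = (encodeList encodeMask tpl).reverse)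
    (hc : m.cc = List.replicate c true) (hN : c + tpl.length ≤ N) :
    RunsIn kindProg m.get (tpl.length * (24 * N + 45) + 20) { m with
      mm := rest
      mr := (true :: encodeKind τ).reverse ++ m.mr
      cc := List.replicate (c + tpl.length) true
      acc := (entries encodeNat (slotArgs τ c tpl)).reverse ++ m.acc }.get := by
  have hmove : ∀ (x : Bool) (l : List Bool) (m : Mem), m.mm = x :: l →
      RunsIn (moveBit (.inr .mm) (.inr .mr)) m.get 3
      { m with mm := l, mr := x :: m.mr }.get := fun x l m hb =>
    (runsIn_moveBit (by simp) (by simpa using hb)).congr le_rfl (by simp)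
  have hslots : ∀ (mm mr : List Bool), RunsIn (slotsProg τ) { m with mm := mm, mr := mr }.get
      (tpl.length * (24 * N + 45) + 9) { m with
        mm := mm
        mr := mr
        cc := List.replicate (c + tpl.length) true
        acc := (entries encodeNat (slotArgs τ c tpl)).reverse ++ m.acc }.get :=
    fun mm mr => runsIn_slotsProg τ tpl c N { m with mm := mm, mr := mr } hd hbb hbr hc hN
  have h₀ := hmove _ _ m hm
  match τ, hslots, h₀ with
  | 0, hslots, h₀ =>
    exact (h₀.seq (RunsIn.ite_true rfl ((hmove true rest _ rfl).seq (hslots _ _)))).congr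
      (by omega) (by simp [encodeKind])
  | 1, hslots, h₀ =>
    exact (h₀.seq (RunsIn.ite_false rfl ((hmove false (true :: rest) _ rfl).seq
      (RunsIn.ite_true rfl ((hmove true rest _ rfl).seq (hslots _ _)))))).congr
      (by omega) (by simp [encodeKind])
  | 2, hslots, h₀ =>
    exact (h₀.seq (RunsIn.ite_false rfl ((hmove false (false :: rest) _ rfl).seq
      (RunsIn.ite_false rfl ((hmove false rest _ rfl).seq (hslots _ _)))))).congr
      (by omega) (by simp [encodeKind])

/-- A bound for the time that a row takes. -/
def rowTime (k r : ℕ) : ℕ := r * (k * (24 * (r * k) + 45) + 21) + 2 * (r * k) + 14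

theorem runsIn_rowProg (tpl : List (Fin 3 → Bool)) (row : List (Fin 3)) (rest : List Bool)
    (m : Mem) (hm : m.mm = encodeList encodeKind row ++ rest)
    (hd : m.dd = []) (hbb : m.bb = []) (hbr : m.br = (encodeList encodeMask tpl).reverse)
    (hc : m.cc = []) :
    RunsIn rowProg m.get (rowTime tpl.length row.length) { m with
      mm := rest
      mr := (encodeList encodeKind row).reverse ++ m.mr
      gg := true :: m.gg
      acc := (encodeClause (clauseArgs tpl 0 row)).reverse ++ m.acc }.get := by
  let I : List (Fin 3) → List (Fin 3) → Mem := fun d l => { m with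
    mm := encodeList encodeKind l ++ rest
    mr := (entries encodeKind d.reverse).reverse ++ m.mr
    cc := List.replicate (d.length * tpl.length) true
    acc := (entries encodeNat (clauseArgs tpl 0 d.reverse)).reverse ++
      true :: true :: true :: m.acc }
  -- The first bit announces a further gate, the other two are the tag of an `or` gate.
  have hstart : RunsIn (pushAll (.inr .acc) [true, true, true]) m.get 5 (I [] row).get :=
    (runsIn_pushAll _ _ _).congr (by simp) (by simp [I, hm, hc, clauseArgs, entries])
  have hbody : ∀ d τ l, d.reverse ++ τ :: l = row → RunsIn kindProg (I d (τ :: l)).get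
      (tpl.length * (24 * (row.length * tpl.length) + 45) + 20) (I (τ :: d) l).get := by
    intro d τ l hl
    have hlen : d.length * tpl.length + tpl.length ≤ row.length * tpl.length := by
      rw [← Nat.succ_mul]
      refine Nat.mul_le_mul_right _ ?_
      have := congrArg List.length hl
      simp at this
      omega
    refine (runsIn_kindProg τ tpl (d.length * tpl.length) _ (encodeList encodeKind l ++ rest)
      (I d (τ :: l)) (by simp [I, encodeList]) hd hbb hbr rfl hlen).congr le_rfl ?_
    simp [I, clauseArgs_append_singleton, entries_append, entries_singleton, Nat.succ_mul]
  have hloop := runsIn_loop_list (a := (.inr .mm : Stk)) (c := isOne) row (fun d l => (I d l).get)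
    (fun d x l hl => ⟨by simp [I, encodeList, isOne], hbody d x l hl⟩)
    (by simp [I, encodeList, isOne])
  have hend := runsIn_moveBit (a := (.inr .mm : Stk)) (b := .inr .mr) (by simp)
      (S := (I row.reverse []).get) (x := false) (l := rest) rfl
  refine RunsIn.congr (hstart.seq (hloop.seq (hend.seq ((runsIn_push _ _ _).seq
    ((runsIn_push _ _ _).seq (runsIn_clear _ _)))))) ?_ ?_
  · simp only [I, Mem.update_mm, Mem.update_mr, Mem.update_acc, Mem.update_gg, Mem.get_cc,
      List.length_replicate, List.length_reverse, rowTime]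
    linarith
  · simp [I, hc, encodeClause, Gate.encode, encodeList_eq_entries]

/-- A bound for the time that a template takes. -/
def templateTime (k r n : ℕ) : ℕ := n * (rowTime k r + 12 * r + 5) + 29 * k + 12

theorem length_encodeList_kind_le (l : List (Fin 3)) :
    (encodeList encodeKind l).length ≤ 3 * l.length + 1 := by
  induction l with
  | nil => simp [encodeList]
  | cons x l ih =>
    have : (encodeKind x).length ≤ 2 := by fin_cases x <;> simp [encodeKind]
    simp [encodeList]; omega

theorem length_flatMap_kind_le {r : ℕ} (rows : List (List (Fin 3)))
    (h : ∀ row ∈ rows, row.length = r) :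
    (rows.flatMap (encodeList encodeKind)).length ≤ rows.length * (3 * r + 1) := by
  induction rows with
  | nil => simp
  | cons row rows ih =>
    have h₁ := length_encodeList_kind_le row
    rw [h row (by simp)] at h₁
    have h₂ := ih fun x hx => h x (by simp [hx])
    simp only [List.flatMap_cons, List.length_append, List.length_cons]
    linarith

/-- Codes of lists are never empty, so the outer loops over rows and templates can stop when the
stack is empty and need no end marker. -/
theorem isSome_head?_encodeList_append {α : Type} (e : α → List Bool) (l : List α)
    (w : List Bool) : (encodeList e l ++ w).head?.isSome = true := by
  cases l <;> simp [encodeList]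

/-- The rows travel from `mr` to `mm` and back, so every template finds them in place. -/
theorem runsIn_templateProg (tpl : List (Fin 3 → Bool)) (rows : List (List (Fin 3))) (r : ℕ)
    (hr : ∀ row ∈ rows, row.length = r) (rest : List Bool)
    (m : Mem) (hp : m.pp = encodeList encodeMask tpl ++ rest)
    (hmm : m.mm = []) (hmr : m.mr = (rows.flatMap (encodeList encodeKind)).reverse)
    (hd : m.dd = []) (hbb : m.bb = []) (hbr : m.br = []) (hc : m.cc = []) :
    RunsIn templateProg m.get (templateTime tpl.length r rows.length) { m with
      pp := rest
      gg := List.replicate rows.length true ++ m.gg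
      acc := ((rows.map (clauseArgs tpl 0)).flatMap encodeClause).reverse ++ m.acc }.get := by
  have hmove : ∀ (x : Bool) (l : List Bool) (m : Mem), m.pp = x :: l →
      RunsIn (moveBit pp (.inr .br)) m.get 3
      { m with pp := l, br := x :: m.br }.get := fun x l m hb =>
    (runsIn_moveBit (by simp) (by simpa using hb)).congr le_rfl (by simp)
  have hread := runsIn_loop_list (a := pp) (c := isOne) (T := 12)
    (p := moveBit pp (.inr .br) ;; moveBit pp (.inr .br) ;; moveBit pp (.inr .br) ;;
      moveBit pp (.inr .br)) tpl
    (fun d l => { m with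
      pp := encodeList encodeMask l ++ rest
      br := (entries encodeMask d.reverse).reverse }.get)
    (fun d x l _ => ⟨by simp [encodeList, isOne],
      ((hmove true (encodeMask x ++ (encodeList encodeMask l ++ rest)) _
          (by simp [encodeList])).seq
        ((hmove (x 0) (x 1 :: x 2 :: (encodeList encodeMask l ++ rest)) _ rfl).seq
        ((hmove (x 1) (x 2 :: (encodeList encodeMask l ++ rest)) _ rfl).seq
        (hmove (x 2) (encodeList encodeMask l ++ rest) _ rfl)))).congr le_rfl
        (by simp [entries_append, entries_singleton, encodeMask])⟩)
    (by simp [encodeList, isOne])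
  let I : List (List (Fin 3)) → List (List (Fin 3)) → Mem := fun d l => { m with
    pp := rest
    br := (encodeList encodeMask tpl).reverse
    mm := l.flatMap (encodeList encodeKind)
    mr := (d.reverse.flatMap (encodeList encodeKind)).reverse
    gg := List.replicate d.length true ++ m.gg
    acc := ((d.reverse.map (clauseArgs tpl 0)).flatMap encodeClause).reverse ++ m.acc }
  have hread' : RunsIn (.loop pp isOne (moveBit pp (.inr .br) ;; moveBit pp (.inr .br) ;;
      moveBit pp (.inr .br) ;; moveBit pp (.inr .br)) ;; moveBit pp (.inr .br)) m.get
      (13 * tpl.length + 4)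
      { m with pp := rest, br := (encodeList encodeMask tpl).reverse }.get := by
    have e : m.get = { m with
        pp := encodeList encodeMask tpl ++ rest
        br := (entries encodeMask [].reverse).reverse }.get := by
      rw [← hp]
      change m.get = { m with br := [] }.get
      rw [← hbr]
    rw [e]
    exact (hread.seq (hmove false rest _ (by simp [encodeList]))).congr (by omega)
      (by simp [encodeList_eq_entries])
  have hpour : RunsIn (pour (.inr .mr) (.inr .mm))
      { m with pp := rest, br := (encodeList encodeMask tpl).reverse }.get
      (4 * (rows.length * (3 * r + 1)) + 1) (I [] rows).get :=
    (runsIn_pour (by simp) _).congr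
      (by
        have := length_flatMap_kind_le rows hr
        simp only [Mem.get_mr, hmr, List.length_reverse]
        omega)
      (by simp [I, hmm, hmr])
  have hbody : ∀ d row l, d.reverse ++ row :: l = rows → RunsIn rowProg (I d (row :: l)).get
      (rowTime tpl.length r) (I (row :: d) l).get := by
    intro d row l hl
    rw [← hr row (by rw [← hl]; simp)]
    refine (runsIn_rowProg tpl row (l.flatMap (encodeList encodeKind)) (I d (row :: l))
      (by simp [I]) hd hbb rfl hc).congr le_rfl ?_
    simp [I, List.replicate_succ]
  have hloop := runsIn_loop_list (a := (.inr .mm : Stk)) (c := Option.isSome) rows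
    (fun d l => (I d l).get)
    (fun d x l hl => ⟨isSome_head?_encodeList_append _ _ _, hbody d x l hl⟩)
    (by simp [I])
  -- The run is split at its middle state to match the bracketing of `templateProg`.
  obtain ⟨t₁, ht₁, h₁⟩ := hread'
  cases h₁ with
  | seq ha hb =>
    refine RunsIn.congr (RunsIn.seq ha.runsIn (RunsIn.seq hb.runsIn (hpour.seq (hloop.seq
      (runsIn_clear _ _))))) ?_ ?_
    · simp only [I, Mem.get_br, List.length_reverse, length_encodeList_mask, templateTime]
      linarith
    · simp [I, hmm, hmr, hbr]

theorem runsIn_clausesProg (tpls : List (List (Fin 3 → Bool))) (rows : List (List (Fin 3)))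
    (k r : ℕ) (hk : ∀ tpl ∈ tpls, tpl.length = k) (hr : ∀ row ∈ rows, row.length = r)
    (m : Mem) (hp : m.pp = tpls.flatMap (encodeList encodeMask))
    (hmm : m.mm = []) (hmr : m.mr = (rows.flatMap (encodeList encodeKind)).reverse)
    (hd : m.dd = []) (hbb : m.bb = []) (hbr : m.br = []) (hc : m.cc = []) (hg : m.gg = []) :
    RunsIn clausesProg m.get (tpls.length * (templateTime k r rows.length + 1) + 1) { m with
      pp := []
      gg := List.replicate (clauses tpls rows).length true
      acc := ((clauses tpls rows).flatMap encodeClause).reverse ++ m.acc }.get := by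
  let I : List (List (Fin 3 → Bool)) → List (List (Fin 3 → Bool)) → Mem := fun d l => { m with
    pp := l.flatMap (encodeList encodeMask)
    gg := List.replicate (clauses d.reverse rows).length true
    acc := ((clauses d.reverse rows).flatMap encodeClause).reverse ++ m.acc }
  have hbody : ∀ d tpl l, d.reverse ++ tpl :: l = tpls → RunsIn templateProg (I d (tpl :: l)).get
      (templateTime k r rows.length) (I (tpl :: d) l).get := by
    intro d tpl l hl
    rw [← hk tpl (by rw [← hl]; simp)]
    refine (runsIn_templateProg tpl rows r hr (l.flatMap (encodeList encodeMask)) (I d (tpl :: l))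
      (by simp [I]) hmm hmr hd hbb hbr hc).congr le_rfl ?_
    simp [I, clauses, Nat.add_mul, Nat.add_comm]
  have hloop := runsIn_loop_list (a := pp) (c := Option.isSome) tpls
    (fun d l => (I d l).get)
    (fun d x l hl => ⟨isSome_head?_encodeList_append _ _ _, hbody d x l hl⟩)
    (by simp [I])
  have e : m.get = (I [] tpls).get := by
    simp only [I, ← hp]
    change m.get = { m with gg := [] }.get
    rw [← hg]
  rw [e]
  exact hloop.congr le_rfl (by simp [I])

/-! ### Reading the input -/

/-- Read the numbers of the input. -/
def parseProg : Prog Stk :=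
  .loop (.inr .inp) isOne (.pop (.inr .inp) ;; .push (.inr .nn) true) ;; .pop (.inr .inp) ;;
  pushAll main [false, false] ;;
  .loop (.inr .inp) isOne (.pop (.inr .inp) ;; .push (.inr .kk) true ;; .push main true) ;;
  .pop (.inr .inp) ;; .push main true

theorem runsIn_parseProg (n k : ℕ) (bits : List Bool) (m : Mem)
    (hi : m.inp = encodeNat n ++ (encodeNat k ++ bits)) (hn : m.nn = []) (hk : m.kk = [])
    (hm : m.main = []) :
    RunsIn parseProg m.get (3 * n + 4 * k + 9) { m with
      inp := bits
      nn := List.replicate n true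
      kk := List.replicate k true
      main := encodeList encodeNat [k] }.get := by
  let I : ℕ → ℕ → Mem := fun d r => { m with
    inp := encodeNat r ++ (encodeNat k ++ bits)
    nn := List.replicate d true }
  have h₁ := runsIn_loop_nat (a := (.inr .inp : Stk)) (c := isOne) (T := 2)
    (p := .pop (.inr .inp) ;; .push (.inr .nn) true) n (fun d r => (I d r).get)
    (fun d r _ => ⟨by simp [I, encodeNat, isOne], ((runsIn_pop _ _).seq (runsIn_push _ _ _)).congr
      le_rfl (by simp [I, encodeNat, List.replicate_succ])⟩) (by simp [I, encodeNat, isOne])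
  -- While `kk` is filled, the code of the list `[k]` grows on `main`: the two zeros at the bottom
  -- end the number and the list.
  let J : ℕ → ℕ → Mem := fun d r => { m with
    inp := encodeNat r ++ bits
    nn := List.replicate n true
    kk := List.replicate d true
    main := List.replicate d true ++ [false, false] }
  have h₂ := runsIn_loop_nat (a := (.inr .inp : Stk)) (c := isOne) (T := 3)
    (p := .pop (.inr .inp) ;; .push (.inr .kk) true ;; .push main true) k (fun d r => (J d r).get)
    (fun d r _ => ⟨by simp [J, encodeNat, isOne],
      ((runsIn_pop _ _).seq ((runsIn_push _ _ _).seq (runsIn_push _ _ _))).congr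
      le_rfl (by simp [J, encodeNat, List.replicate_succ])⟩) (by simp [J, encodeNat, isOne])
  have e : m.get = (I 0 n).get := by
    simp only [I, ← hi]
    change m.get = { m with nn := [] }.get
    rw [← hn]
  have hmid : RunsIn (pushAll main [false, false]) (Function.update (I n 0).get (.inr .inp)
      ((I n 0).get (.inr .inp)).tail) 4 (J 0 k).get :=
    (runsIn_pushAll _ _ _).congr le_rfl (by simp [I, J, hk, hm, encodeNat])
  rw [e]
  refine RunsIn.congr (h₁.seq ((runsIn_pop _ _).seq (hmid.seq (h₂.seq ((runsIn_pop _ _).seq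
    (runsIn_push _ _ _)))))) (by omega) ?_
  have := replicate_append_encodeNat k [false]
  simp [J, encodeNat, encodeList, this]

/-! ### Reading the adjacency matrix -/

/-- The kind of a vertex other than the one that the row belongs to, given its bit in the row. -/
def bitKind (b : Bool) : Fin 3 := if b then 1 else 2

/-- Turn as many bits from stack `i` into kinds on stack `o` as there are `1`s on stack `a`, which
are moved to stack `b`. -/
def copyBits {K : Type} (a b i o : K) : Prog K :=
  .loop a Option.isSome (moveBit a b ;;
    .ite i isOne (pushAll o [true, false, true]) (pushAll o [true, false, false]) ;; .pop i)

theorem runsIn_copyBits {K : Type} [DecidableEq K] {a b i o : K} (hab : a ≠ b) (hai : a ≠ i)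
    (hao : a ≠ o) (hbi : b ≠ i) (hbo : b ≠ o) (hio : i ≠ o) (w rest : List Bool)
    {S : K → List Bool} (ha : S a = List.replicate w.length true) (hi : S i = w ++ rest) :
    RunsIn (copyBits a b i o) S (11 * w.length + 1)
      (Function.update (Function.update (Function.update (Function.update S a [])
        b (List.replicate w.length true ++ S b)) i rest)
        o ((entries encodeKind (w.map bitKind)).reverse ++ S o)) := by
  let I : List Bool → List Bool → K → List Bool := fun d l =>
    (Function.update (Function.update (Function.update
      (Function.update S a (List.replicate l.length true))
      b (List.replicate d.length true ++ S b)) i (l ++ rest))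
      o ((entries encodeKind (d.reverse.map bitKind)).reverse ++ S o))
  have hbody : ∀ d x l, RunsIn (moveBit a b ;;
      .ite i isOne (pushAll o [true, false, true]) (pushAll o [true, false, false]) ;; .pop i)
      (I d (x :: l)) 10 (I (x :: d) l) := by
    intro d x l
    have h₁ := runsIn_moveBit hab (S := I d (x :: l)) (x := true)
      (l := List.replicate l.length true) (by simp [I, hab, hai, hao, List.replicate_succ])
    have h₂ : RunsIn (.ite i isOne (pushAll o [true, false, true]) (pushAll o [true, false, false]))
        (Function.update (Function.update (I d (x :: l)) a (List.replicate l.length true)) b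
          (true :: I d (x :: l) b)) 6
        (Function.update (Function.update (Function.update (I d (x :: l)) a
          (List.replicate l.length true)) b (true :: I d (x :: l) b)) o
          ((true :: encodeKind (bitKind x)).reverse ++ I d (x :: l) o)) := by
      cases x
      · exact .ite_false (by simp [I, hio, hbi.symm, hai.symm, isOne])
          ((runsIn_pushAll _ _ _).congr le_rfl (by simp [hao.symm, hbo.symm, encodeKind, bitKind]))
      · exact .ite_true (by simp [I, hio, hbi.symm, hai.symm, isOne])
          ((runsIn_pushAll _ _ _).congr le_rfl (by simp [hao.symm, hbo.symm, encodeKind, bitKind]))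
    refine (h₁.seq (h₂.seq (runsIn_pop _ _))).congr le_rfl ?_
    funext j
    by_cases ho : j = o
    · subst ho
      simp [I, hio.symm, entries_append, entries_singleton]
    by_cases hi : j = i
    · subst hi
      simp [I, hio, hbi.symm, hai.symm]
    by_cases hb : j = b
    · subst hb
      simp [I, hbo, hbi, List.replicate_succ]
    by_cases ha : j = a
    · subst ha
      simp [I, hao, hai, hab]
    · simp [I, ho, hi, hb, ha]
  have h := runsIn_loop_list (a := a) (c := Option.isSome) w I
    (fun d x l _ => ⟨by simp [I, hab, hai, hao, List.replicate_succ], hbody d x l⟩)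
    (by simp [I, hab, hai, hao])
  have e : I [] w = S := by
    simp [I, entries, ← ha, ← hi]
  rw [e] at h
  exact h.congr (by omega) (by simp [I])

/-- Turn a row of the adjacency matrix into a row of kinds. -/
def matrixRowProg : Prog Stk :=
  .pop (.inr .ra) ;; copyBits (.inr .la) (.inr .lb) (.inr .inp) (.inr .mr) ;;
  .pop (.inr .inp) ;; pushAll (.inr .mr) [true, true] ;;
  copyBits (.inr .ra) (.inr .rb) (.inr .inp) (.inr .mr) ;;
  pushAll (.inr .mr) [true, false, false, false] ;;
  pour (.inr .lb) (.inr .la) ;; pour (.inr .rb) (.inr .ra) ;; .push (.inr .la) true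

/-- Turn the adjacency matrix into rows of kinds. -/
def matrixProg : Prog Stk := .loop (.inr .ra) Option.isSome matrixRowProg

/-- The diagonal bit is replaced by kind 0, and kind 2 is appended for the blank choice. The stacks
`la` and `ra` measure the two sides of the diagonal, which moves on by one place per row. -/
theorem runsIn_matrixRowProg (w₁ w₂ rest : List Bool) (b : Bool) (m : Mem)
    (hi : m.inp = w₁ ++ b :: (w₂ ++ rest)) (hla : m.la = List.replicate w₁.length true)
    (hra : m.ra = List.replicate (w₂.length + 1) true) (hlb : m.lb = []) (hrb : m.rb = []) :
    RunsIn matrixRowProg m.get (15 * (w₁.length + w₂.length) + 17) { m with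
      inp := rest
      la := List.replicate (w₁.length + 1) true
      ra := List.replicate w₂.length true
      mr := (encodeList encodeKind
        (w₁.map bitKind ++ 0 :: (w₂.map bitKind ++ [2]))).reverse ++ m.mr }.get := by
  have h₁ := runsIn_copyBits (a := (.inr .la : Stk)) (b := .inr .lb) (i := .inr .inp)
    (o := .inr .mr) (by simp) (by simp) (by simp) (by simp) (by simp) (by simp) w₁
    (b :: (w₂ ++ rest)) (S := { m with ra := List.replicate w₂.length true }.get)
    (by simpa using hla) (by simpa using hi)
  simp only [Mem.update_la, Mem.update_lb, Mem.update_inp, Mem.update_mr, Mem.get_lb,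
    Mem.get_mr] at h₁
  have h₀ : RunsIn (.pop (.inr .ra)) m.get 1 { m with ra := List.replicate w₂.length true }.get :=
    (runsIn_pop _ _).congr le_rfl (by simp [hra])
  let m₂ : Mem := { m with
    la := []
    lb := List.replicate w₁.length true
    ra := List.replicate w₂.length true
    inp := w₂ ++ rest
    mr := (entries encodeKind (w₁.map bitKind ++ [0])).reverse ++ m.mr }
  have h₁' : RunsIn (copyBits (.inr .la) (.inr .lb) (.inr .inp) (.inr .mr))
      { m with ra := List.replicate w₂.length true }.get (11 * w₁.length + 1)
      { m₂ with
        inp := b :: (w₂ ++ rest)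
        mr := (entries encodeKind (w₁.map bitKind)).reverse ++ m.mr }.get :=
    h₁.congr le_rfl (by simp [m₂, hlb])
  have hpush : RunsIn (pushAll (.inr .mr) [true, true]) { m₂ with
      mr := (entries encodeKind (w₁.map bitKind)).reverse ++ m.mr }.get 4 m₂.get :=
    (runsIn_pushAll _ _ _).congr le_rfl
      (by simp [m₂, entries_append, entries_singleton, encodeKind])
  have hpop : RunsIn (.pop (.inr .inp)) { m₂ with
        inp := b :: (w₂ ++ rest)
        mr := (entries encodeKind (w₁.map bitKind)).reverse ++ m.mr }.get 1 { m₂ with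
      mr := (entries encodeKind (w₁.map bitKind)).reverse ++ m.mr }.get :=
    (runsIn_pop _ _).congr le_rfl (by simp [m₂])
  let m₃ : Mem := { m₂ with
    ra := []
    rb := List.replicate w₂.length true
    inp := rest
    mr := (entries encodeKind (w₂.map bitKind)).reverse ++ m₂.mr }
  have h₃ : RunsIn (copyBits (.inr .ra) (.inr .rb) (.inr .inp) (.inr .mr)) m₂.get
      (11 * w₂.length + 1) m₃.get :=
    (runsIn_copyBits (S := m₂.get) (a := (.inr .ra : Stk)) (b := .inr .rb) (i := .inr .inp)
      (o := .inr .mr) (by simp) (by simp) (by simp) (by simp) (by simp) (by simp) w₂ rest rfl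
      rfl).congr le_rfl (by simp [m₃, m₂, hrb])
  refine RunsIn.congr (h₀.seq (h₁'.seq (hpop.seq (hpush.seq (h₃.seq ((runsIn_pushAll _ _ _).seq
    ((runsIn_pour (by simp) _).seq ((runsIn_pour (by simp) _).seq (runsIn_push _ _ _))))))))) ?_ ?_
  · simp only [m₃, m₂, Mem.update_mr, Mem.update_la, Mem.update_lb, Mem.get_lb, Mem.get_rb,
      List.length_replicate, List.length_cons, List.length_nil]
    omega
  · have e : w₁.map bitKind ++ 0 :: (w₂.map bitKind ++ [2]) =
        w₁.map bitKind ++ [0] ++ w₂.map bitKind ++ [2] := by simp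
    rw [e]
    simp [m₃, m₂, hlb, hrb, encodeList_eq_entries, entries_append, entries_singleton, encodeKind,
      List.replicate_succ, -List.append_assoc]
    simp

theorem ofFn_kind {n : ℕ} (G : SimpleGraph (Fin n)) (v : Fin n) (w : List Bool)
    (hw : w.length = n) (h : ∀ u : Fin n, w[(u : ℕ)] = true ↔ G.Adj v u) :
    List.ofFn (kind G v) =
      (w.take v).map bitKind ++ 0 :: ((w.drop (v + 1)).map bitKind ++ [2]) := by
  have hv := v.2
  have hother : ∀ u : Fin n, u ≠ v → kind G v u.castSucc = bitKind w[(u : ℕ)] := by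
    intro u hu
    by_cases hadj : G.Adj v u
    · rw [(h u).2 hadj, kind_eq_one.2 ⟨u, rfl, hadj⟩]
      rfl
    · have : w[(u : ℕ)] = false := by simpa [hadj] using h u
      simp [this, kind, hu, hadj, bitKind]
  refine List.ext_getElem (by simp; omega) fun i hi _ => ?_
  rw [List.length_ofFn] at hi
  rw [List.getElem_ofFn]
  rcases lt_trichotomy i v with h' | h' | h'
  · rw [List.getElem_append_left (by simp; omega)]
    have := hother ⟨i, by omega⟩ (by simp [Fin.ext_iff]; omega)
    rw [Fin.castSucc_mk] at this
    simpa using this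
  · rw [List.getElem_append_right (by simp; omega), kind_eq_zero.2 (Fin.ext h')]
    simp [h', hw]
  · rw [List.getElem_append_right (by simp; omega)]
    obtain ⟨j, rfl⟩ : ∃ j, i = v + (j + 1) := ⟨i - v - 1, by omega⟩
    have e : (v : ℕ) + (j + 1) - min (v : ℕ) n = j + 1 := by omega
    simp only [List.length_map, List.length_take, hw, e, List.getElem_cons_succ]
    by_cases hj : v + (j + 1) < n
    · have := hother ⟨v + (j + 1), hj⟩ (by simp [Fin.ext_iff])
      rw [Fin.castSucc_mk] at this
      rw [List.getElem_append_left (by simp; omega), this]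
      simp [Nat.add_comm, Nat.add_left_comm]
    · rw [List.getElem_append_right (by simp; omega)]
      have h₂ : ∀ u : Fin n, (⟨v + (j + 1), hi⟩ : Fin (n + 1)) ≠ u.castSucc := fun u hu => by
        have := congrArg Fin.val hu
        simp at this
        omega
      simp [kind, h₂]

/-- The bits of a row of the adjacency matrix. -/
noncomputable def adjRow {n : ℕ} (G : SimpleGraph (Fin n)) (v : Fin n) : List Bool :=
  open Classical in (List.finRange n).map fun u => decide (G.Adj v u)

theorem adjBits_eq {n : ℕ} (G : SimpleGraph (Fin n)) :
    adjBits G = (List.finRange n).flatMap (adjRow G) := rfl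

theorem runsIn_matrixProg {n : ℕ} (G : SimpleGraph (Fin n)) (m : Mem)
    (hi : m.inp = adjBits G) (hla : m.la = []) (hra : m.ra = List.replicate n true)
    (hlb : m.lb = []) (hrb : m.rb = []) (hmr : m.mr = []) :
    RunsIn matrixProg m.get (n * (15 * n + 18) + 1) { m with
      inp := []
      la := List.replicate n true
      ra := []
      mr := ((rows G).flatMap (encodeList encodeKind)).reverse }.get := by
  let I : List (Fin n) → List (Fin n) → Mem := fun d l => { m with
    inp := l.flatMap (adjRow G)
    la := List.replicate d.length true
    ra := List.replicate l.length true
    mr := ((d.reverse.map fun v => List.ofFn (kind G v)).flatMap (encodeList encodeKind)).reverse }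
  have hbody : ∀ d v l, d.reverse ++ v :: l = List.finRange n →
      RunsIn matrixRowProg (I d (v :: l)).get (15 * n + 17) (I (v :: d) l).get := by
    intro d v l hl
    have hlen := congrArg List.length hl
    simp only [List.length_append, List.length_reverse, List.length_cons,
      List.length_finRange] at hlen
    -- The rows come in the order of the vertices, so the number of finished rows is the position of
    -- the diagonal.
    have hv : (v : ℕ) = d.length := by
      have h := List.getElem_finRange (i := d.length) (n := n) (by simp; omega)
      simp only [← hl] at h
      rw [List.getElem_append_right (by simp)] at h
      simpa [Fin.ext_iff] using h
    have hw : (adjRow G v).length = n := by simp [adjRow]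
    have hkind := ofFn_kind G v (adjRow G v) hw (fun u => by simp [adjRow])
    have hsplit : adjRow G v = (adjRow G v).take v ++
        (adjRow G v)[(v : ℕ)]'(by omega) :: (adjRow G v).drop (v + 1) := by simp
    refine (runsIn_matrixRowProg ((adjRow G v).take v) ((adjRow G v).drop (v + 1))
      (l.flatMap (adjRow G)) ((adjRow G v)[(v : ℕ)]'(by omega)) (I d (v :: l)) ?_ ?_ ?_ hlb
      hrb).congr ?_ ?_
    · simp only [I, List.flatMap_cons]
      rw [← List.cons_append, ← List.append_assoc, ← hsplit]
    · simp [I, hw]; omega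
    · simp [I, hw]; omega
    · simp [hw]; omega
    · have e₁ : min d.length n = d.length := by omega
      have e₂ : n - (d.length + 1) = l.length := by omega
      rw [← hkind]
      simp [I, hw, hv, e₁, e₂, -List.ofFn_succ]
  have hloop := runsIn_loop_list (a := (.inr .ra : Stk)) (c := Option.isSome) (List.finRange n)
    (fun d l => (I d l).get)
    (fun d x l hl => ⟨by simp [I, List.replicate_succ], hbody d x l hl⟩) (by simp [I])
  have e : m.get = (I [] (List.finRange n)).get := by
    simp only [I, ← adjBits_eq, ← hi, List.length_finRange, ← hra, List.length_nil,
      List.replicate_zero, List.reverse_nil, List.map_nil, List.flatMap_nil]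
    cases m
    cases hla
    cases hmr
    rfl
  rw [e]
  exact hloop.congr (by simp) (by simp [I, rows])

/-! ### The remaining parts of the output -/

/-- Write the parameter and the number of variables. -/
def headerProg : Prog Stk :=
  emitNum (.inr .kk) (.inr .dd) (.inr .acc) ;;
  addNum (.inr .kk) (.inr .dd) (.inr .ee) ;;
  .loop (.inr .nn) Option.isSome (moveBit (.inr .nn) (.inr .ra) ;;
    addNum (.inr .kk) (.inr .dd) (.inr .ee)) ;;
  emitNum (.inr .ee) (.inr .dd) (.inr .acc)

/-- The product `(n + 1) * k` is formed by adding `k` once for the blank and once per vertex, while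
`n` moves to `ra`, where the matrix program expects it. -/
theorem runsIn_headerProg (n k : ℕ) (m : Mem) (hn : m.nn = List.replicate n true)
    (hk : m.kk = List.replicate k true) (hd : m.dd = []) (he : m.ee = []) (hra : m.ra = []) :
    RunsIn headerProg m.get (n * (8 * k + 6) + 8 * ((n + 1) * k) + 16 * k + 9) { m with
      nn := []
      ra := List.replicate n true
      ee := List.replicate ((n + 1) * k) true
      acc := (encodeNat k ++ encodeNat ((n + 1) * k)).reverse ++ m.acc }.get := by
  let I : ℕ → ℕ → Mem := fun d r => { m with
    nn := List.replicate r true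
    ra := List.replicate d true
    ee := List.replicate ((d + 1) * k) true
    acc := (encodeNat k).reverse ++ m.acc }
  have h₁ : RunsIn (emitNum (.inr .kk) (.inr .dd) (.inr .acc)) m.get (8 * k + 3)
      { m with acc := (encodeNat k).reverse ++ m.acc }.get :=
    (runsIn_emitNum (S := m.get) (by simp) (by simp) (by simp) (by exact hk) (by exact hd)).congr
      le_rfl (by simp)
  have h₂ : RunsIn (addNum (.inr .kk) (.inr .dd) (.inr .ee))
      { m with acc := (encodeNat k).reverse ++ m.acc }.get (8 * k + 2) (I 0 n).get :=
    (runsIn_addNum (S := { m with acc := (encodeNat k).reverse ++ m.acc }.get)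
      (by simp) (by simp) (by simp) (by exact hk) (by exact hd)).congr le_rfl
      (by simp only [I, List.replicate_zero, ← hn, ← hra]; simp [he])
  have hbody : ∀ d r, RunsIn (moveBit (.inr .nn) (.inr .ra) ;;
      addNum (.inr .kk) (.inr .dd) (.inr .ee)) (I d (r + 1)).get (8 * k + 5) (I (d + 1) r).get := by
    intro d r
    have h : RunsIn (moveBit (.inr .nn) (.inr .ra)) (I d (r + 1)).get 3
        { I d r with ra := List.replicate (d + 1) true }.get :=
      (runsIn_moveBit (S := (I d (r + 1)).get) (x := true) (l := List.replicate r true) (by simp)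
        (by simp [I, List.replicate_succ])).congr le_rfl (by simp [I, List.replicate_succ])
    refine (h.seq (runsIn_addNum (S := { I d r with ra := List.replicate (d + 1) true }.get)
      (by simp) (by simp) (by simp) (by exact hk) (by exact hd))).congr (by omega) ?_
    have e : (d + 1 + 1) * k = k + (d + 1) * k := by ring
    simp [I, e]
  have h₃ := runsIn_loop_nat (a := (.inr .nn : Stk)) (c := Option.isSome) n
    (fun d r => (I d r).get) (fun d r _ => ⟨by simp [I, List.replicate_succ], hbody d r⟩)
    (by simp [I])
  have h₄ : RunsIn (emitNum (.inr .ee) (.inr .dd) (.inr .acc)) (I n 0).get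
      (8 * ((n + 1) * k) + 3) { m with
        nn := []
        ra := List.replicate n true
        ee := List.replicate ((n + 1) * k) true
        acc := (encodeNat k ++ encodeNat ((n + 1) * k)).reverse ++ m.acc }.get :=
    (runsIn_emitNum (S := (I n 0).get) (by simp) (by simp) (by simp) (by rfl)
      (by exact hd)).congr le_rfl (by simp [I])
  exact (h₁.seq (h₂.seq (h₃.seq h₄))).mono (by linarith)

/-- Write the gate that collects all clauses, and the number of the output node. -/
def footerProg : Prog Stk :=
  pushAll (.inr .acc) [true, true, false] ;;
  .loop (.inr .gg) Option.isSome (.pop (.inr .gg) ;; .push (.inr .acc) true ;;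
    emitNum (.inr .ee) (.inr .dd) (.inr .acc) ;; .push (.inr .ee) true) ;;
  pushAll (.inr .acc) [false, false] ;;
  emitNum (.inr .ee) (.inr .dd) (.inr .acc)

/-- Growing by one per clause, `ee` always holds the number of the next clause node, and in the end
that of the collecting gate, which is the output. -/
theorem runsIn_footerProg (N M : ℕ) (m : Mem) (he : m.ee = List.replicate N true)
    (hg : m.gg = List.replicate M true) (hd : m.dd = []) :
    RunsIn footerProg m.get (M * (8 * (N + M) + 7) + 8 * (N + M) + 13) { m with
      gg := []
      ee := List.replicate (N + M) true
      acc := (true :: ((Gate.and (List.range' N M)).encode ++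
        (false :: encodeNat (N + M)))).reverse ++ m.acc }.get := by
  let I : ℕ → ℕ → Mem := fun d r => { m with
    gg := List.replicate r true
    ee := List.replicate (N + d) true
    acc := (entries encodeNat (List.range' N d)).reverse ++ false :: true :: true :: m.acc }
  have h₁ : RunsIn (pushAll (.inr .acc) [true, true, false]) m.get 5 (I 0 M).get :=
    (runsIn_pushAll _ _ _).congr le_rfl (by simp [I, entries, ← he, ← hg])
  have hbody : ∀ d r, d + (r + 1) = M → RunsIn (.pop (.inr .gg) ;; .push (.inr .acc) true ;;
      emitNum (.inr .ee) (.inr .dd) (.inr .acc) ;; .push (.inr .ee) true) (I d (r + 1)).get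
      (8 * (N + M) + 6) (I (d + 1) r).get := by
    intro d r hr
    have h : RunsIn (.pop (.inr .gg)) (I d (r + 1)).get 1 (I d r).get :=
      (runsIn_pop _ _).congr le_rfl (by simp [I])
    have h' : RunsIn (.push (.inr .acc) true) (I d r).get 1
        { I d r with acc := true :: (I d r).acc }.get :=
      (runsIn_push _ _ _).congr le_rfl (by simp)
    refine (h.seq (h'.seq ((runsIn_emitNum (n := N + d)
      (S := { I d r with acc := true :: (I d r).acc }.get)
      (by simp) (by simp) (by simp) (by rfl) (by exact hd)).seq (runsIn_push _ _ _)))).congr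
      (by omega) ?_
    simp [I, List.range'_1_concat, entries_append, entries_singleton, ← List.replicate_succ,
      Nat.add_assoc]
  have h₂ := runsIn_loop_nat (a := (.inr .gg : Stk)) (c := Option.isSome) M
    (fun d r => (I d r).get) (fun d r hr => ⟨by simp [I, List.replicate_succ], hbody d r hr⟩)
    (by simp [I])
  have h₃ : RunsIn (pushAll (.inr .acc) [false, false]) (I M 0).get 4
      { I M 0 with acc := false :: false :: (I M 0).acc }.get :=
    (runsIn_pushAll _ _ _).congr le_rfl (by simp)
  refine (h₁.seq (h₂.seq (h₃.seq (runsIn_emitNum (n := N + M)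
    (S := { I M 0 with acc := false :: false :: (I M 0).acc }.get)
    (by simp) (by simp) (by simp) (by rfl) (by exact hd))))).congr (by linarith) ?_
  simp [I, Gate.encode, encodeList_eq_entries]

/-- Put the output in its place and empty all other stacks. -/
def cleanupProg : Prog Stk :=
  pour (.inr .acc) (.inr .out) ;; clear (.inr .kk) ;; clear (.inr .la) ;; clear (.inr .mr) ;;
  clear (.inr .ee)

theorem runsIn_cleanupProg (m : Mem) :
    RunsIn cleanupProg m.get (12 * ∑ s, (m.get s).length + 5) { m with
      out := m.acc.reverse ++ m.out
      acc := []
      kk := []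
      la := []
      mr := []
      ee := [] }.get := by
  have hle : ∀ s, (m.get s).length ≤ ∑ s, (m.get s).length := fun s =>
    Finset.single_le_sum (f := fun s => (m.get s).length) (fun _ _ => Nat.zero_le _)
      (Finset.mem_univ s)
  have h₁ := hle (.inr .acc)
  have h₂ := hle (.inr .kk)
  have h₃ := hle (.inr .la)
  have h₄ := hle (.inr .mr)
  have h₅ := hle (.inr .ee)
  generalize ∑ s, (m.get s).length = Z at *
  refine RunsIn.congr ((runsIn_pour (by simp) _).seq ((runsIn_clear _ _).seq
    ((runsIn_clear _ _).seq ((runsIn_clear _ _).seq (runsIn_clear _ _))))) ?_ ?_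
  · simp at *
    omega
  · simp

/-! ### The whole program. -/

/-- The stacks are empty. -/
def Mem.nil : Mem := ⟨[], [], [], [], [], [], [], [], [], [], [], [], [], [], [], [], [], [], []⟩

theorem Mem.get_nil : Mem.nil.get = fun _ => [] := by
  funext s
  rcases s with s | s
  · fin_cases s <;> rfl
  · cases s <;> rfl

/-- The program of the reduction, given a program `p` for the templates. -/
def writeProg (p : Prog (Fin 4)) : Prog Stk :=
  parseProg ;; p.map Sum.inl ;; headerProg ;; matrixProg ;; clausesProg ;; footerProg

/-- A bound for the time that it takes to write the output, if there are `τ` templates. -/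
def writeTime (n k τ t : ℕ) : ℕ :=
  (3 * n + 4 * k + 9) + (t + ((n * (8 * k + 6) + 8 * ((n + 1) * k) + 16 * k + 9) +
    ((n * (15 * n + 18) + 1) + ((τ * (templateTime k (n + 1) n + 1) + 1) +
      (τ * n * (8 * ((n + 1) * k + τ * n) + 7) + 8 * ((n + 1) * k + τ * n) + 13)))))

theorem length_clauses (tpls : List (List (Fin 3 → Bool))) (rows : List (List (Fin 3))) :
    (clauses tpls rows).length = tpls.length * rows.length := by
  simp [clauses]

theorem encode_reduction (χσ χρ : ℕ → Bool) (x : GraphInst) :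
    (weightedCircuitSat 2 2).encode (reduction χσ χρ x) =
      encodeNat x.k ++ encodeNat ((x.n + 1) * x.k) ++
      (clauses (templates χσ χρ x.k) (rows x.G)).flatMap encodeClause ++
      (true :: ((Gate.and (List.range' ((x.n + 1) * x.k)
        (clauses (templates χσ χρ x.k) (rows x.G)).length)).encode ++
        (false :: encodeNat ((x.n + 1) * x.k +
          (clauses (templates χσ χρ x.k) (rows x.G)).length)))) := by
  simp [weightedCircuitSat, reduction, circuit, Circuit.encode, cnfCircuit, encodeList_eq_entries,
    entries_append, entries_singleton]
  rw [entries, List.flatMap_map]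
  rfl

theorem runsIn_writeProg {χσ χρ : ℕ → Bool} (x : GraphInst) {p : Prog (Fin 4)} {t : ℕ}
    (hp : Runs p (quad (encodeList encodeNat [x.k]) [] [] []) t
      (quad [] (templateBits χσ χρ x.k) [] [])) :
    RunsIn (writeProg p) { Mem.nil with inp := x.encode }.get
      (writeTime x.n x.k (templates χσ χρ x.k).length t)
      { Mem.nil with
        kk := List.replicate x.k true
        la := List.replicate x.n true
        mr := ((rows x.G).flatMap (encodeList encodeKind)).reverse
        ee := List.replicate ((x.n + 1) * x.k +
          (clauses (templates χσ χρ x.k) (rows x.G)).length) true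
        acc := ((weightedCircuitSat 2 2).encode (reduction χσ χρ x)).reverse }.get := by
  have h₁ := runsIn_parseProg x.n x.k (adjBits x.G) { Mem.nil with inp := x.encode } rfl rfl rfl rfl
  have h₂ := (hp.map_inl { Mem.nil with
    inp := adjBits x.G
    nn := List.replicate x.n true
    kk := List.replicate x.k true }.reg).runsIn
  have h₃ := runsIn_headerProg x.n x.k { Mem.nil with
    pp := templateBits χσ χρ x.k
    inp := adjBits x.G
    nn := List.replicate x.n true
    kk := List.replicate x.k true } rfl rfl rfl rfl rfl
  have h₄ := runsIn_matrixProg x.G { Mem.nil with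
    pp := templateBits χσ χρ x.k
    inp := adjBits x.G
    kk := List.replicate x.k true
    ra := List.replicate x.n true
    ee := List.replicate ((x.n + 1) * x.k) true
    acc := (encodeNat x.k ++ encodeNat ((x.n + 1) * x.k)).reverse ++ [] } rfl rfl rfl rfl rfl rfl
  have h₅ := runsIn_clausesProg (templates χσ χρ x.k) (rows x.G) x.k (x.n + 1)
    (fun tpl h => length_of_mem_templatesOf h) (by simp [rows]) { Mem.nil with
    pp := templateBits χσ χρ x.k
    kk := List.replicate x.k true
    la := List.replicate x.n true
    mr := ((rows x.G).flatMap (encodeList encodeKind)).reverse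
    ee := List.replicate ((x.n + 1) * x.k) true
    acc := (encodeNat x.k ++ encodeNat ((x.n + 1) * x.k)).reverse ++ [] }
    rfl rfl rfl rfl rfl rfl rfl rfl
  have h₆ := runsIn_footerProg ((x.n + 1) * x.k) (clauses (templates χσ χρ x.k) (rows x.G)).length
    { Mem.nil with
      kk := List.replicate x.k true
      la := List.replicate x.n true
      mr := ((rows x.G).flatMap (encodeList encodeKind)).reverse
      ee := List.replicate ((x.n + 1) * x.k) true
      gg := List.replicate (clauses (templates χσ χρ x.k) (rows x.G)).length true
      acc := ((clauses (templates χσ χρ x.k) (rows x.G)).flatMap encodeClause).reverse ++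
        ((encodeNat x.k ++ encodeNat ((x.n + 1) * x.k)).reverse ++ []) } rfl rfl rfl
  have hrows : (rows x.G).length = x.n := by simp [rows]
  refine RunsIn.congr (h₁.seq (h₂.seq (h₃.seq (h₄.seq (h₅.seq h₆))))) ?_ ?_
  · rw [length_clauses, hrows, writeTime]
  · rw [encode_reduction]
    simp only [List.reverse_append, List.append_nil, List.append_assoc, Mem.nil]

/-- Cleaning up costs at most 12 times the total stack length plus 5, and that length is at most the
input length plus the writing time; hence the factor 13 = 1 + 12. -/
theorem runsIn_reduction {χσ χρ : ℕ → Bool} (x : GraphInst) {p : Prog (Fin 4)} {t : ℕ}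
    (hp : Runs p (quad (encodeList encodeNat [x.k]) [] [] []) t
      (quad [] (templateBits χσ χρ x.k) [] [])) :
    RunsIn (writeProg p ;; cleanupProg) (Function.update (fun _ => []) (.inr .inp) x.encode)
      (13 * writeTime x.n x.k (templates χσ χρ x.k).length t + 12 * x.encode.length + 5)
      (Function.update (fun _ => []) (.inr .out)
        ((weightedCircuitSat 2 2).encode (reduction χσ χρ x))) := by
  rw [← Mem.get_nil, Mem.update_inp, Mem.update_out]
  obtain ⟨T, hT, h⟩ := runsIn_writeProg x hp
  have hlen := h.sum_length_le
  have hin : ∑ s, ({ Mem.nil with inp := x.encode }.get s).length = x.encode.length := by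
    rw [← Mem.update_inp, Mem.get_nil, Finset.sum_eq_single (.inr .inp : Stk)]
    · simp
    · intro s _ hs
      simp [hs]
    · simp
  rw [hin] at hlen
  refine (h.runsIn.seq (runsIn_cleanupProg _)).congr (by omega) ?_
  simp [Mem.nil]

/-! ### The running time -/

theorem writeTime_le (n k τ t : ℕ) :
    writeTime n k τ t ≤ 315 * ((τ + 1) ^ 2 * (k + 1) ^ 2 * (n + 1) ^ 3) + t := by
  have mono : ∀ {i j l : ℕ}, i ≤ 2 → j ≤ 2 → l ≤ 3 →
      (τ + 1) ^ i * (k + 1) ^ j * (n + 1) ^ l ≤ (τ + 1) ^ 2 * (k + 1) ^ 2 * (n + 1) ^ 3 :=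
    fun hi hj hl => by gcongr <;> simp [*]
  -- With all quantities raised to at least 1, each monomial is dominated by the largest one; 315 is
  -- the sum of the coefficients.
  have h : writeTime n k τ t ≤ (3 * (n + 1) + 4 * (k + 1) + 9) + (t +
      (((n + 1) * (8 * (k + 1) + 6) + 8 * ((n + 1) * (k + 1)) + 16 * (k + 1) + 9) +
      (((n + 1) * (15 * (n + 1) + 18) + 1) + (((τ + 1) * ((n + 1) * (((n + 1) * ((k + 1) *
        (24 * ((n + 1) * (k + 1)) + 45) + 21) + 2 * ((n + 1) * (k + 1)) + 14) + 12 * (n + 1) + 5) +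
        29 * (k + 1) + 12 + 1) + 1) +
      ((τ + 1) * (n + 1) * (8 * ((n + 1) * (k + 1) + (τ + 1) * (n + 1)) + 7) +
        8 * ((n + 1) * (k + 1) + (τ + 1) * (n + 1)) + 13))))) := by
    unfold writeTime templateTime rowTime
    gcongr <;> simp
  have h₁ := mono (i := 0) (j := 0) (l := 0) (by simp) (by simp) (by simp)
  have h₂ := mono (i := 0) (j := 0) (l := 1) (by simp) (by simp) (by simp)
  have h₃ := mono (i := 0) (j := 0) (l := 2) (by simp) (by simp) (by simp)
  have h₄ := mono (i := 0) (j := 1) (l := 0) (by simp) (by simp) (by simp)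
  have h₅ := mono (i := 0) (j := 1) (l := 1) (by simp) (by simp) (by simp)
  have h₆ := mono (i := 1) (j := 0) (l := 0) (by simp) (by simp) (by simp)
  have h₇ := mono (i := 1) (j := 0) (l := 1) (by simp) (by simp) (by simp)
  have h₈ := mono (i := 1) (j := 0) (l := 2) (by simp) (by simp) (by simp)
  have h₉ := mono (i := 1) (j := 1) (l := 0) (by simp) (by simp) (by simp)
  have h₁₀ := mono (i := 1) (j := 1) (l := 2) (by simp) (by simp) (by simp)
  have h₁₁ := mono (i := 1) (j := 2) (l := 3) (by simp) (by simp) (by simp)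
  have h₁₂ := mono (i := 2) (j := 0) (l := 2) (by simp) (by simp) (by simp)
  clear mono
  refine h.trans ?_
  generalize τ + 1 = s at *
  generalize k + 1 = q at *
  generalize n + 1 = a at *
  linarith

/-- The number of templates is thereby bounded by the length of the computable table. -/
theorem length_templates_le (χσ χρ : ℕ → Bool) (k : ℕ) :
    (templates χσ χρ k).length ≤ (templateBits χσ χρ k).length := by
  rw [templateBits, List.length_flatMap]
  have : ∀ tpl : List (Fin 3 → Bool), 1 ≤ (encodeList encodeMask tpl).length := fun tpl => by
    cases tpl <;> simp [encodeList]
  simpa using List.card_nsmul_le_sum ((templates χσ χρ k).map fun tpl =>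
    (encodeList encodeMask tpl).length) 1 (by simpa using fun tpl _ => this tpl)

theorem lt_length_encode (x : GraphInst) : x.n < x.encode.length := by
  have : ∀ n, (encodeNat n).length = n + 1 := fun n => by
    rw [← List.length_reverse, reverse_encodeNat]; simp
  simp [GraphInst.encode, this]
  omega

theorem fptReducible (σ ρ : Set ℕ) (hσ : ComputablePred fun n : ℕ => n ∈ σ)
    (hρ : ComputablePred fun n : ℕ => n ∈ ρ) :
    FPTReducible (sigmaRhoDominatingSet σ ρ) (weightedCircuitSat 2 2) := by
  obtain ⟨χσ, hχσ, hσ⟩ := ComputablePred.computable_iff.1 hσ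
  obtain ⟨χρ, hχρ, hρ⟩ := ComputablePred.computable_iff.1 hρ
  have hbits := computable_templateBits hχσ hχρ
  obtain ⟨p, t, ht, hp⟩ := exists_table_prog hbits
  let s : ℕ → ℕ := fun k => ((templateBits χσ χρ k).length + 1) * (k + 1)
  have hs : Computable s := Primrec.nat_mul.to_comp.comp
    (Computable.succ.comp (Computable.list_length.comp hbits)) Computable.succ
  -- The summand 18 absorbs the terms 12 · |x| + 5 and leaves room for the halting step.
  let f : ℕ → ℕ := fun k => 13 * (315 * (s k * s k) + t k) + 18
  have hf : Computable f := Primrec.nat_add.to_comp.comp (Primrec.nat_mul.to_comp.comp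
    (Computable.const 13) (Primrec.nat_add.to_comp.comp (Primrec.nat_mul.to_comp.comp
    (Computable.const 315) (Primrec.nat_mul.to_comp.comp hs hs)) ht)) (Computable.const 18)
  refine ⟨reduction χσ χρ, f, id, 3, (writeProg p ;; cleanupProg).computer (.inr .inp) (.inr .out),
    hf, Computable.id, yes_iff (fun j => (iff_of_eq (congrFun hσ j)).symm)
      (fun j => (iff_of_eq (congrFun hρ j)).symm), fun x => le_rfl, fun x => ?_⟩
  have hT : 13 * writeTime x.n x.k (templates χσ χρ x.k).length (t x.k) + 12 * x.encode.length + 5 <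
      f x.k * (x.encode.length + 1) ^ 3 := by
    have h₁ : writeTime x.n x.k (templates χσ χρ x.k).length (t x.k) ≤
        315 * (s x.k * s x.k) * (x.encode.length + 1) ^ 3 + t x.k := by
      refine (writeTime_le _ _ _ _).trans ?_
      have e : s x.k * s x.k = ((templateBits χσ χρ x.k).length + 1) ^ 2 * (x.k + 1) ^ 2 := by
        simp only [s]; ring
      rw [e, Nat.mul_assoc 315]
      gcongr
      · exact length_templates_le _ _ _
      · exact (lt_length_encode x).le
    have h₂ : x.encode.length + 1 ≤ (x.encode.length + 1) ^ 3 := Nat.le_self_pow (by simp) _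
    have h₃ : t x.k ≤ t x.k * (x.encode.length + 1) ^ 3 :=
      Nat.le_mul_of_pos_right _ (by positivity)
    simp only [f]
    linarith
  -- The strict inequality leaves the one step that the machine needs to halt.
  obtain ⟨T, hT'⟩ := Nat.exists_eq_add_of_lt hT
  have := ((runsIn_reduction x (hp x.k)).mono (Nat.le_add_right _ T)).outputsInTime
  rw [← hT'] at this
  exact this

end SigmaRho

theorem theorem2 (σ ρ : Set ℕ) (hσ : ComputablePred fun n : ℕ => n ∈ σ)
    (hρ : ComputablePred fun n : ℕ => n ∈ ρ) :
    ParamComplexity.sigmaRhoDominatingSet σ ρ ∈ ParamComplexity.W 2 := by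
  exact ⟨2, SigmaRho.fptReducible σ ρ hσ hρ⟩
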